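/- Let $p,q$ be positive integers with $q\ge 2$ and $p\le \frac12 q(q-1)$. A metric 2-step nilpotent Lie algebra of type $(p,q)$ is a finite-dimensional real Lie algebra $\mathfrak N$ with an inner product such that $[[x,y],z]=0$ for all $x,y,z$ and such that $[\mathfrak N,\mathfrak N]$ has dimension $p$ and codimension $q$ in $\mathfrak N$. Let $I(p,q)$ be the set of isometry classes (classes under linear isometries that are Lie algebra isomorphisms) of such algebras. For a linearly independent tuple $C=(C_1,\dots,C_p)$ in $\mathfrak{so}(q,\mathbb R)$ let $\mathfrak N_C=\mathbb R^q\oplus\mathbb R^p$, with its standard inner product, $\mathbb R^p$ central and $[v,w]=\sum_k (C_kv\cdot w)\,e_k$ for $v,w\in\mathbb R^q$; every class contains some $\mathfrak N_C$, and $I(p,q)$ carries the quotient topology of the map $C\mapsto[\mathfrak N_C]$ from the space of linearly independent $p$-tuples. Let $G(p,\mathfrak{so}(q,\mathbb R))$ be the Grassmann manifold of $p$-dimensional subspaces of $\mathfrak{so}(q,\mathbb R)$, and for $W\in G(p,\mathfrak{so}(q,\mathbb R))$ let $\mathfrak N_W=\mathbb R^q\oplus W$ (orthogonal direct sum) be the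 standard form: $\langle X,Y\rangle=\operatorname{trace}(XY^{T})$ on $W$, $W$ is central, and $\langle[v,w],Z\rangle=Z(v)\cdot w$ for $v,w\in\mathbb R^q$, $Z\in W$. There is a dense open subset $U'$ of $I(p,q)$ such that the ($O(q,\mathbb R)$-conjugation invariant) set of all $W\in G(p,\mathfrak{so}(q,\mathbb R))$ with $[\mathfrak N_W]\in U'$ is also dense and open in $G(p,\mathfrak{so}(q,\mathbb R))$, and such that the following holds. Let $\mathfrak N$ be any metric 2-step nilpotent Lie algebra of type $(p,q)$ whose isometry class lies in $U'$, and let $N$ be the simply connected Lie group with Lie algebra $\mathfrak N$ and the corresponding left invariant Riemannian metric. Then there is a dense open subset $O$ of full Lebesgue measure in $[\mathfrak N,\mathfrak N]$ such that for each nonzero $Z\in O$ the geodesic $\gamma_Z(t)=\exp(tZ)$ of $N$ has exactly $P=\lfloor q/2\rfloor$ distinct primitive conjugate values. Here $t>0$ is a conjugate value of $\gamma_Z$ if $\gamma_Z(t)$ is conjugate to $\gamma_Z(0)$ along $\gamma_Z$, that is, some nonzero Jacobi field along $\gamma_Z$ vanishes at $0$ and at $t$; a conjugate value is primitive if it is not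 of the form $mt_0$ with an integer $m\ge 2$ and a conjugate value $t_0$. -/

import Mathlib

open scoped ContDiff

noncomputable section

/-! ## Riemannian geometry of a metric given in one global chart

`g x u v` is the inner product at the point `x` of the tangent vectors `u`, `v`; every tangent
space of the vector space `E` is identified with `E`. -/

section Chart

variable {E : Type*} [NormedAddCommGroup E] [NormedSpace ℝ E]

/-- The Christoffel symbols `Γ_x(u, v)`, that is `∇_u v` at `x` for the constant vector fields
`u`, `v` and the Levi-Civita connection `∇` of `g`: the vector determined by
`2 g(Γ(u,v), w) = u g(v,w) + v g(u,w) - w g(u,v)` for all `w`.  It exists and is unique for a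
smooth Riemannian metric `g` on a finite-dimensional space. -/
def christoffel (g : E → E → E → ℝ) (x u v : E) : E :=
  Classical.epsilon fun c : E => ∀ w : E,
    2 * g x c w = fderiv ℝ (fun y => g y v w) x u + fderiv ℝ (fun y => g y u w) x v
      - fderiv ℝ (fun y => g y u v) x w

/-- The covariant derivative of a vector field `Y` along a curve `γ`. -/
def covDerivAlong (g : E → E → E → ℝ) (γ Y : ℝ → E) (t : ℝ) : E :=
  deriv Y t + christoffel g (γ t) (deriv γ t) (Y t)

/-- The curvature tensor `R(u,v)w = ∇_u ∇_v w - ∇_v ∇_u w - ∇_[u,v] w`. -/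
def curvatureTensor (g : E → E → E → ℝ) (x u v w : E) : E :=
  fderiv ℝ (fun y => christoffel g y v w) x u - fderiv ℝ (fun y => christoffel g y u w) x v
    + christoffel g x u (christoffel g x v w) - christoffel g x v (christoffel g x u w)

/-- `Y` is a (smooth) Jacobi vector field along the geodesic `γ`:
`Y'' + R(Y, γ') γ' = 0`. -/
def IsJacobiField (g : E → E → E → ℝ) (γ Y : ℝ → E) : Prop :=
  ContDiff ℝ ∞ Y ∧ ∀ t : ℝ,
    covDerivAlong g γ (covDerivAlong g γ Y) t
      + curvatureTensor g (γ t) (Y t) (deriv γ t) (deriv γ t) = 0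

/-- `γ b` is conjugate to `γ a` along the geodesic `γ`. -/
def AreConjugateAlong (g : E → E → E → ℝ) (γ : ℝ → E) (a b : ℝ) : Prop :=
  ∃ Y : ℝ → E, IsJacobiField g γ Y ∧ Y ≠ 0 ∧ Y a = 0 ∧ Y b = 0

end Chart

/-- Lebesgue null sets of a finite-dimensional real inner product space. -/
def IsLebesgueNull {V : Type*} [NormedAddCommGroup V] [InnerProductSpace ℝ V]
    [FiniteDimensional ℝ V] (S : Set V) : Prop :=
  letI : MeasurableSpace V := borel V
  haveI : BorelSpace V := ⟨rfl⟩
  MeasureTheory.volume S = 0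

/-- The commutator ideal `[𝔑, 𝔑]`, the linear span of all brackets. -/
def derivedSpan {E : Type*} [AddCommGroup E] [Module ℝ E] (B : E →ₗ[ℝ] E →ₗ[ℝ] E) :
    Submodule ℝ E :=
  Submodule.span ℝ {z : E | ∃ x y : E, B x y = z}

/-- A metric 2-step nilpotent Lie algebra of type `(p, q)`: a finite-dimensional real inner
product space with an alternating bilinear bracket such that `[[x, y], z] = 0` (which contains
the Jacobi identity), for which `[𝔑, 𝔑]` has dimension `p` and codimension `q`.
It is not abelian as soon as `0 < p`. -/
structure MetricLieAlgebra (p q : ℕ) where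
  carrier : Type
  [normedAddCommGroup : NormedAddCommGroup carrier]
  [innerProductSpace : InnerProductSpace ℝ carrier]
  [finiteDimensional : FiniteDimensional ℝ carrier]
  bracket : carrier →ₗ[ℝ] carrier →ₗ[ℝ] carrier
  bracket_self : ∀ x, bracket x x = 0
  bracket_bracket : ∀ x y z, bracket (bracket x y) z = 0
  finrank_derived : Module.finrank ℝ (derivedSpan bracket) = p
  finrank_carrier : Module.finrank ℝ carrier = p + q

attribute [instance] MetricLieAlgebra.normedAddCommGroup
attribute [instance] MetricLieAlgebra.innerProductSpace
attribute [instance] MetricLieAlgebra.finiteDimensional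

namespace MetricLieAlgebra

variable {p q : ℕ}

theorem bracket_skew (N : MetricLieAlgebra p q) (x y : N.carrier) :
    N.bracket x y = - N.bracket y x := by
  have h := N.bracket_self (x + y)
  simp only [map_add, LinearMap.add_apply, N.bracket_self] at h
  rw [zero_add, add_zero] at h
  exact eq_neg_of_add_eq_zero_right h

theorem bracket_bracket' (N : MetricLieAlgebra p q) (x y z : N.carrier) :
    N.bracket x (N.bracket y z) = 0 := by
  rw [N.bracket_skew, N.bracket_bracket, neg_zero]

/-- The commutator ideal `[𝔑, 𝔑]`. -/
abbrev derived (N : MetricLieAlgebra p q) : Submodule ℝ N.carrier := derivedSpan N.bracket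

/-- The simply connected Lie group with Lie algebra `𝔑`, written in exponential coordinates:
the manifold is the vector space `𝔑`, the exponential map is the identity, and by the
Baker-Campbell-Hausdorff formula the product is `x y = x + y + [x, y] / 2`. -/
@[reducible] def group (N : MetricLieAlgebra p q) : Group N.carrier where
  mul x y := x + y + (1 / 2 : ℝ) • N.bracket x y
  one := 0
  inv x := - x
  mul_assoc a b c := by
    change a + b + (1 / 2 : ℝ) • N.bracket a b + c
        + (1 / 2 : ℝ) • N.bracket (a + b + (1 / 2 : ℝ) • N.bracket a b) c
      = a + (b + c + (1 / 2 : ℝ) • N.bracket b c)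
        + (1 / 2 : ℝ) • N.bracket a (b + c + (1 / 2 : ℝ) • N.bracket b c)
    simp only [map_add, map_smul, LinearMap.add_apply, LinearMap.smul_apply, N.bracket_bracket,
      N.bracket_bracket', smul_zero, add_zero, smul_add]
    abel
  one_mul a := by
    change 0 + a + (1 / 2 : ℝ) • N.bracket 0 a = a
    simp
  mul_one a := by
    change a + 0 + (1 / 2 : ℝ) • N.bracket a 0 = a
    simp
  inv_mul_cancel a := by
    change - a + a + (1 / 2 : ℝ) • N.bracket (- a) a = 0
    simp [N.bracket_self]

/-- Left translation `y ↦ a y` of the Lie group. -/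
def leftTranslation (N : MetricLieAlgebra p q) (a y : N.carrier) : N.carrier :=
  N.group.mul a y

/-- The left invariant Riemannian metric on the Lie group which is the given inner product at
the identity: `⟨u, v⟩_x = ⟨dL(u), dL(v)⟩`, where `L` is left translation by `x⁻¹`. -/
def metric (N : MetricLieAlgebra p q) (x u v : N.carrier) : ℝ :=
  inner ℝ (fderiv ℝ (N.leftTranslation (N.group.inv x)) x u)
    (fderiv ℝ (N.leftTranslation (N.group.inv x)) x v)

/-- `γ_Z(t) = exp(t Z)`, which is a geodesic for `Z ∈ [𝔑, 𝔑]`. -/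
def geodesic (N : MetricLieAlgebra p q) (Z : N.carrier) (t : ℝ) : N.carrier := t • Z

/-- `t` is a conjugate value of `γ_Z`: `t > 0`, and `γ_Z(t)` is conjugate to `γ_Z(0)`
along `γ_Z`. -/
def IsConjugateValue (N : MetricLieAlgebra p q) (Z : N.carrier) (t : ℝ) : Prop :=
  0 < t ∧ AreConjugateAlong N.metric (N.geodesic Z) 0 t

/-- A conjugate value is primitive if it is not `m t₀` for an integer `m ≥ 2` and a conjugate
value `t₀`. -/
def IsPrimitiveConjugateValue (N : MetricLieAlgebra p q) (Z : N.carrier) (t : ℝ) : Prop :=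
  N.IsConjugateValue Z t ∧
    ¬ ∃ m : ℕ, 2 ≤ m ∧ ∃ t₀ : ℝ, N.IsConjugateValue Z t₀ ∧ t = m * t₀

/-- Isometric isomorphism of metric Lie algebras. -/
def Isometric (N M : MetricLieAlgebra p q) : Prop :=
  ∃ φ : N.carrier ≃ₗᵢ[ℝ] M.carrier, ∀ x y, φ (N.bracket x y) = M.bracket (φ x) (φ y)

/-- The equivalence relation of isometric isomorphism. -/
instance isometricSetoid (p q : ℕ) : Setoid (MetricLieAlgebra p q) where
  r := Isometric
  iseqv :=
    { refl := fun N => ⟨LinearIsometryEquiv.refl ℝ N.carrier, fun _ _ => rfl⟩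
      symm := by
        rintro N M ⟨φ, hφ⟩
        refine ⟨φ.symm, fun x y => ?_⟩
        apply φ.injective
        rw [hφ]
        simp
      trans := by
        rintro N M K ⟨φ, hφ⟩ ⟨ψ, hψ⟩
        refine ⟨φ.trans ψ, fun x y => ?_⟩
        simp [hφ, hψ] }

end MetricLieAlgebra

/-! ## The Lie algebra `ℝ^q ⊕ W` of an injective linear map `j : W → 𝔰𝔬(q, ℝ)` -/

/-- The skew symmetric `q × q` matrices. -/
abbrev SO (q : ℕ) : Type := ↥(LieAlgebra.Orthogonal.so (Fin q) ℝ)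

section FromJ

variable {q : ℕ} {W : Type} [NormedAddCommGroup W] [InnerProductSpace ℝ W]
  [FiniteDimensional ℝ W]

/-- The linear form `Z ↦ j(Z)v · w` on `W`. -/
def jForm (j : W →ₗ[ℝ] SO q) (v w : EuclideanSpace ℝ (Fin q)) : W →ₗ[ℝ] ℝ where
  toFun Z := inner ℝ (Matrix.toEuclideanLin (j Z : Matrix (Fin q) (Fin q) ℝ) v) w
  map_add' a b := by simp [inner_add_left]
  map_smul' c a := by simp [inner_smul_left]

/-- The bracket `[v, w] ∈ W` of `v, w ∈ ℝ^q`, determined by `⟨[v, w], Z⟩ = j(Z)v · w`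
for all `Z ∈ W`. -/
def jBracket (j : W →ₗ[ℝ] SO q) (v w : EuclideanSpace ℝ (Fin q)) : W :=
  (InnerProductSpace.toDual ℝ W).symm (LinearMap.toContinuousLinearMap (jForm j v w))

theorem inner_jBracket (j : W →ₗ[ℝ] SO q) (v w : EuclideanSpace ℝ (Fin q)) (Z : W) :
    inner ℝ (jBracket j v w) Z
      = inner ℝ (Matrix.toEuclideanLin (j Z : Matrix (Fin q) (Fin q) ℝ) v) w := by
  simp [jBracket, jForm]

/-- The bracket on `ℝ^q ⊕ W` for which `W` is central and `⟨[v, w], Z⟩ = j(Z)v · w`. -/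
def jLie (j : W →ₗ[ℝ] SO q) :
    WithLp 2 (EuclideanSpace ℝ (Fin q) × W) →ₗ[ℝ] WithLp 2 (EuclideanSpace ℝ (Fin q) × W) →ₗ[ℝ]
      WithLp 2 (EuclideanSpace ℝ (Fin q) × W) :=
  LinearMap.mk₂ ℝ (fun x y => WithLp.toLp 2 (0, jBracket j x.fst y.fst))
    (fun x y z => by
      rw [← WithLp.toLp_add]; congr 1; ext1
      · simp
      · refine ext_inner_right ℝ fun Z => ?_
        simp [inner_add_left, inner_jBracket])
    (fun c x y => by
      rw [← WithLp.toLp_smul]; congr 1; ext1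
      · simp
      · refine ext_inner_right ℝ fun Z => ?_
        simp [inner_smul_left, inner_jBracket])
    (fun x y z => by
      rw [← WithLp.toLp_add]; congr 1; ext1
      · simp
      · refine ext_inner_right ℝ fun Z => ?_
        simp [inner_add_left, inner_add_right, inner_jBracket])
    (fun c x y => by
      rw [← WithLp.toLp_smul]; congr 1; ext1
      · simp
      · refine ext_inner_right ℝ fun Z => ?_
        simp [inner_smul_left, inner_smul_right, inner_jBracket])

theorem jLie_apply (j : W →ₗ[ℝ] SO q) (x y : WithLp 2 (EuclideanSpace ℝ (Fin q) × W)) :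
    jLie j x y = WithLp.toLp 2 (0, jBracket j x.fst y.fst) := rfl

theorem skew_inner_self (A : SO q) (v : EuclideanSpace ℝ (Fin q)) :
    inner ℝ (Matrix.toEuclideanLin (A : Matrix (Fin q) (Fin q) ℝ) v) v = 0 := by
  have hA := (LieAlgebra.Orthogonal.mem_so _ _ _).1 A.2
  have h : inner ℝ (Matrix.toEuclideanLin (A : Matrix (Fin q) (Fin q) ℝ) v) v
      = - inner ℝ (Matrix.toEuclideanLin (A : Matrix (Fin q) (Fin q) ℝ) v) v := by
    conv_lhs => rw [← LinearMap.adjoint_inner_right, ← Matrix.toEuclideanLin_conjTranspose_eq_adjoint,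
      Matrix.conjTranspose_eq_transpose_of_trivial, hA]
    rw [map_neg, LinearMap.neg_apply, inner_neg_right, real_inner_comm]
  linarith

theorem finrank_derivedSpan_jLie (j : W →ₗ[ℝ] SO q) (hj : Function.Injective j) :
    Module.finrank ℝ (derivedSpan (jLie j)) = Module.finrank ℝ W := by
  have htop : Submodule.span ℝ {z : W | ∃ v w, jBracket j v w = z} = ⊤ := by
    rw [← Submodule.orthogonal_eq_bot_iff, eq_bot_iff]
    intro Z hZ
    rw [Submodule.mem_bot]
    apply hj
    rw [map_zero]
    apply Subtype.ext
    apply (Matrix.toEuclideanLin (𝕜 := ℝ) (m := Fin q) (n := Fin q)).injective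
    rw [ZeroMemClass.coe_zero, map_zero]
    refine LinearMap.ext fun v => ?_
    refine ext_inner_right ℝ fun w => ?_
    rw [← inner_jBracket, LinearMap.zero_apply, inner_zero_left]
    exact (Submodule.mem_orthogonal _ _).1 hZ _ (Submodule.subset_span ⟨v, w, rfl⟩)
  let ι : W →ₗ[ℝ] WithLp 2 (EuclideanSpace ℝ (Fin q) × W) :=
    (WithLp.linearEquiv 2 ℝ (EuclideanSpace ℝ (Fin q) × W)).symm.toLinearMap ∘ₗ
      LinearMap.inr ℝ _ _
  have hι : Function.Injective ι :=
    (WithLp.linearEquiv 2 ℝ (EuclideanSpace ℝ (Fin q) × W)).symm.injective.comp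
      LinearMap.inr_injective
  have hmap : derivedSpan (jLie j)
      = (Submodule.span ℝ {z : W | ∃ v w, jBracket j v w = z}).map ι := by
    rw [derivedSpan, Submodule.map_span]
    congr 1
    ext z
    constructor
    · rintro ⟨x, y, rfl⟩
      exact ⟨_, ⟨x.fst, y.fst, rfl⟩, rfl⟩
    · rintro ⟨_, ⟨v, w, rfl⟩, rfl⟩
      exact ⟨WithLp.toLp 2 (v, 0), WithLp.toLp 2 (w, 0), rfl⟩
  rw [hmap, htop, Submodule.map_top, LinearMap.finrank_range_of_inj hι]

/-- The metric 2-step nilpotent Lie algebra `ℝ^q ⊕ W` (orthogonal direct sum) of an injective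
linear map `j : W → 𝔰𝔬(q, ℝ)`: `W` is central and `⟨[v, w], Z⟩ = j(Z)v · w` for `v, w ∈ ℝ^q`
and `Z ∈ W`. -/
def metricLieOfJ {p : ℕ} (j : W →ₗ[ℝ] SO q) (hj : Function.Injective j)
    (hp : Module.finrank ℝ W = p) : MetricLieAlgebra p q where
  carrier := WithLp 2 (EuclideanSpace ℝ (Fin q) × W)
  bracket := jLie j
  bracket_self x := by
    rw [jLie_apply]
    have h : jBracket j x.fst x.fst = 0 := by
      refine ext_inner_right ℝ fun Z => ?_
      rw [inner_jBracket, skew_inner_self, inner_zero_left]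
    rw [h]; rfl
  bracket_bracket x y z := by
    rw [jLie_apply, jLie_apply]
    have h : jBracket j (0 : EuclideanSpace ℝ (Fin q)) z.fst = 0 := by
      refine ext_inner_right ℝ fun Z => ?_
      rw [inner_jBracket, map_zero, inner_zero_left, inner_zero_left]
    change WithLp.toLp 2 (0, jBracket j (0 : EuclideanSpace ℝ (Fin q)) z.fst) = 0
    rw [h]; rfl
  finrank_derived := by rw [finrank_derivedSpan_jLie j hj, hp]
  finrank_carrier := by
    rw [LinearEquiv.finrank_eq (WithLp.linearEquiv 2 ℝ (EuclideanSpace ℝ (Fin q) × W)),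
      Module.finrank_prod, finrank_euclideanSpace_fin, hp, add_comm]

end FromJ

/-! ## The space `I(p, q)` and the Grassmannian `G(p, 𝔰𝔬(q, ℝ))` -/

/-- Linearly independent `p`-tuples in `𝔰𝔬(q, ℝ)`, with the topology of `𝔰𝔬(q, ℝ)^p`. They
correspond to the injective linear maps `ℝ^p → 𝔰𝔬(q, ℝ)`. -/
abbrev Frames (p q : ℕ) : Type := {C : Fin p → SO q // LinearIndependent ℝ C}

/-- The injective linear map `z ↦ ∑ z_k C_k`. -/
def frameMap {p q : ℕ} (C : Frames p q) : EuclideanSpace ℝ (Fin p) →ₗ[ℝ] SO q :=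
  Fintype.linearCombination ℝ C.1 ∘ₗ
    (WithLp.linearEquiv 2 ℝ (Fin p → ℝ)).toLinearMap

theorem frameMap_injective {p q : ℕ} (C : Frames p q) : Function.Injective (frameMap C) :=
  (linearIndependent_iff_injective_fintypeLinearCombination.1 C.2).comp
    (WithLp.linearEquiv 2 ℝ (Fin p → ℝ)).injective

/-- The metric Lie algebra `ℝ^q ⊕ ℝ^p` with `[v, w] = ∑ (C_k v · w) e_k`. -/
def metricLieOfFrame {p q : ℕ} (C : Frames p q) : MetricLieAlgebra p q :=
  metricLieOfJ (frameMap C) (frameMap_injective C) finrank_euclideanSpace_fin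

/-- The space `I(p, q)` of isometry classes of metric 2-step nilpotent Lie algebras of type
`(p, q)`. -/
def IsometryClasses (p q : ℕ) : Type 1 := Quotient (MetricLieAlgebra.isometricSetoid p q)

/-- The isometry class of a metric Lie algebra. -/
def isometryClass {p q : ℕ} (N : MetricLieAlgebra p q) : IsometryClasses p q :=
  Quotient.mk (MetricLieAlgebra.isometricSetoid p q) N

/-- Every class contains some `ℝ^q ⊕ ℝ^p` with structure matrices `C_1, …, C_p`; the topology of
`I(p, q)` is the quotient topology from the space of these tuples of matrices. -/
instance isometryClassesTopology (p q : ℕ) : TopologicalSpace (IsometryClasses p q) :=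
  TopologicalSpace.coinduced (fun C : Frames p q => isometryClass (metricLieOfFrame C))
    inferInstance

/-- The Grassmannian `G(p, 𝔰𝔬(q, ℝ))` of `p`-dimensional subspaces. -/
def Grass (p q : ℕ) : Type := {W : Submodule ℝ (SO q) // Module.finrank ℝ W = p}

/-- The span of a linearly independent `p`-tuple. -/
def frameSpan {p q : ℕ} (C : Frames p q) : Grass p q :=
  ⟨Submodule.span ℝ (Set.range C.1), by simpa using finrank_span_eq_card C.2⟩

/-- The usual topology of the Grassmannian, as a quotient of the space of linearly independent
`p`-tuples. -/
instance grassTopology (p q : ℕ) : TopologicalSpace (Grass p q) :=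
  TopologicalSpace.coinduced (frameSpan (p := p) (q := q)) inferInstance

/-- A copy of the subspace `W` of `𝔰𝔬(q, ℝ)`, which carries the inner product
`⟨X, Y⟩ = trace (X Yᵀ)`. -/
def TraceSpace {q : ℕ} (W : Submodule ℝ (SO q)) : Type := ↥W

instance {q : ℕ} (W : Submodule ℝ (SO q)) : AddCommGroup (TraceSpace W) :=
  inferInstanceAs (AddCommGroup ↥W)

instance {q : ℕ} (W : Submodule ℝ (SO q)) : Module ℝ (TraceSpace W) :=
  inferInstanceAs (Module ℝ ↥W)

/-- The inclusion of `W` into `𝔰𝔬(q, ℝ)`. -/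
def traceIncl {q : ℕ} (W : Submodule ℝ (SO q)) : TraceSpace W →ₗ[ℝ] SO q := W.subtype

theorem traceIncl_injective {q : ℕ} (W : Submodule ℝ (SO q)) :
    Function.Injective (traceIncl W) := W.injective_subtype

instance {q : ℕ} (W : Submodule ℝ (SO q)) : FiniteDimensional ℝ (TraceSpace W) :=
  FiniteDimensional.of_injective (traceIncl W) (traceIncl_injective W)

/-- The inner product `⟨X, Y⟩ = trace (X Yᵀ)`. -/
@[reducible] def traceCore {q : ℕ} (W : Submodule ℝ (SO q)) : InnerProductSpace.Core ℝ (TraceSpace W) where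
  inner X Y := ((traceIncl W X : Matrix (Fin q) (Fin q) ℝ)
    * (traceIncl W Y : Matrix (Fin q) (Fin q) ℝ).transpose).trace
  conj_inner_symm X Y := by
    rw [← Matrix.trace_transpose]
    simp
  re_inner_nonneg X := by
    simp only [Matrix.trace, Matrix.diag, Matrix.mul_apply, Matrix.transpose_apply, RCLike.re_to_real]
    exact Finset.sum_nonneg fun i _ => Finset.sum_nonneg fun k _ => mul_self_nonneg _
  add_left X Y Z := by simp [add_mul]
  smul_left X Y r := by simp
  definite X h := by
    apply traceIncl_injective W
    rw [map_zero]
    apply Subtype.ext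
    rw [← Matrix.conjTranspose_eq_transpose_of_trivial, Matrix.trace_mul_conjTranspose_self_eq_zero_iff] at h
    rw [h]; rfl

instance {q : ℕ} (W : Submodule ℝ (SO q)) : NormedAddCommGroup (TraceSpace W) :=
  (traceCore W).toNormedAddCommGroup

instance {q : ℕ} (W : Submodule ℝ (SO q)) : InnerProductSpace ℝ (TraceSpace W) :=
  InnerProductSpace.ofCore (traceCore W).toCore

/-- The standard form: `ℝ^q ⊕ W` with the inner product `trace (X Yᵀ)` on `W` and
`⟨[v, w], Z⟩ = Z(v) · w`. -/
def standardForm {p q : ℕ} (W : Grass p q) : MetricLieAlgebra p q :=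
  metricLieOfJ (traceIncl W.1) (traceIncl_injective W.1) W.2

end

/-! For `Z` in the commutator ideal let `J = j(Z)` be the skew map with `⟨Jx, y⟩ = ⟨Z, [x, y]⟩`. In
exponential coordinates the covariant derivative along `exp(tZ)` is `Y' - JY/2`, and the curvature
term is `-J²Y/4`, so the Jacobi equation collapses to `Y'' = JY'` (`isJacobiField_iff`). Then `Y' -
JY` is constant, and a solution vanishing at `0` and `t` has `Y'(t) = Y'(0)`. Decomposing along
eigenvectors of `J²` shows that the conjugate values are exactly `2πk/θ`, with `k ≥ 1` and `-θ²` a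
negative eigenvalue of `J²` (`isConjugateValue_iff`). If no frequency `θ` is a proper integer
multiple of another, the primitive ones are the numbers `2π/θ`. It remains to show that generically
there are `⌊q/2⌋` frequencies without such resonances.

For a skew matrix `A` write `χ_A = X^(q mod 2) ρ(X²)`; the nonzero roots of `ρ` are the numbers
`-θ²`. Nonresonance says that countably many polynomials in the entries of `A` do not vanish: the
resultant of `ρ` and `ρ'`, and the resultants of `ρ` with `ρ` rescaled by `ε = 1/m²` or `ε = 0`
(`nonResonant_iff`). The set of these `ε` is compact, which gives openness. A line through a
nonresonant matrix meets the resonant ones in a countable set, which gives density and, by Fubini,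
full measure. An explicit block matrix shows that nonresonant matrices exist.

`U'` consists of the classes for which some `j(Z)` is nonresonant. For a frame `C` this depends only
on the span of `C`, so a single open dense set of frames settles both `I(p, q)` and the
Grassmannian. -/

noncomputable section

/-! ### The Jacobi equation along central geodesics -/

namespace MetricLieAlgebra

variable {p q : ℕ} (N : MetricLieAlgebra p q)

/-- The bilinear map `(Z, x) ↦ j(Z)x` determined by `⟨j(Z)x, y⟩ = ⟨Z, [x, y]⟩`. -/
def jMap : N.carrier →ₗ[ℝ] N.carrier →ₗ[ℝ] N.carrier :=
  LinearMap.mk₂ ℝ (fun Z x => LinearMap.adjoint (N.bracket x) Z)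
    (fun Z Z' x => map_add _ _ _) (fun c Z x => map_smul _ _ _)
    (fun Z x x' => by simp) (fun c Z x => by simp)

theorem inner_jMap (Z x y : N.carrier) : inner ℝ (N.jMap Z x) y = inner ℝ Z (N.bracket x y) := by
  rw [jMap, LinearMap.mk₂_apply, LinearMap.adjoint_inner_left]

theorem inner_jMap_right (Z x y : N.carrier) :
    inner ℝ y (N.jMap Z x) = inner ℝ (N.bracket x y) Z := by
  rw [real_inner_comm, inner_jMap, real_inner_comm]

theorem inner_jMap_skew (Z x y : N.carrier) :
    inner ℝ (N.jMap Z x) y = - inner ℝ x (N.jMap Z y) := by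
  rw [inner_jMap, inner_jMap_right, N.bracket_skew x y, inner_neg_right, real_inner_comm]

theorem bracket_derived {Z : N.carrier} (hZ : Z ∈ N.derived) (x : N.carrier) :
    N.bracket Z x = 0 := by
  have h : N.derived ≤ LinearMap.ker (N.bracket.flip x) := by
    refine Submodule.span_le.2 ?_
    rintro _ ⟨y, z, rfl⟩
    exact N.bracket_bracket y z x
  exact h hZ

theorem bracket_derived_right {Z : N.carrier} (hZ : Z ∈ N.derived) (x : N.carrier) :
    N.bracket x Z = 0 := by
  rw [N.bracket_skew, N.bracket_derived hZ, neg_zero]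

theorem jMap_derived_right {Z : N.carrier} (hZ : Z ∈ N.derived) (x : N.carrier) :
    N.jMap x Z = 0 := by
  refine ext_inner_right ℝ fun y => ?_
  rw [inner_jMap, N.bracket_derived hZ, inner_zero_right, inner_zero_left]

theorem bracket_mem_derived (x y : N.carrier) : N.bracket x y ∈ N.derived :=
  Submodule.subset_span ⟨x, y, rfl⟩

theorem fderiv_leftTranslation (x y u : N.carrier) :
    fderiv ℝ (N.leftTranslation (N.group.inv x)) y u = u - (1 / 2 : ℝ) • N.bracket x u := by
  have h : N.leftTranslation (N.group.inv x) = fun y =>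
      (-x) + y + (1 / 2 : ℝ) • LinearMap.toContinuousLinearMap (N.bracket (-x)) y := rfl
  have hd : HasFDerivAt (N.leftTranslation (N.group.inv x))
      (ContinuousLinearMap.id ℝ N.carrier
        + (1 / 2 : ℝ) • LinearMap.toContinuousLinearMap (N.bracket (-x))) y := by
    rw [h]
    exact ((hasFDerivAt_id y).const_add _).add
      ((LinearMap.toContinuousLinearMap (N.bracket (-x))).hasFDerivAt.const_smul _)
  rw [hd.fderiv]
  simp [sub_eq_add_neg]

theorem metric_eq (x u v : N.carrier) :
    N.metric x u v = inner ℝ (u - (1 / 2 : ℝ) • N.bracket x u) (v - (1 / 2 : ℝ) • N.bracket x v) := by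
  rw [metric, fderiv_leftTranslation, fderiv_leftTranslation]

/-- The hypothesis gives `u = [x, u] / 2`, and bracketing once more with `x` kills the right side by
2-step nilpotency. -/
theorem eq_zero_of_metric_self {x u : N.carrier} (h : N.metric x u u = 0) : u = 0 := by
  rw [metric_eq, inner_self_eq_zero, sub_eq_zero] at h
  have h2 : N.bracket x u = 0 := by
    rw [h, map_smul, N.bracket_bracket', smul_zero]
  rw [h, h2, smul_zero]

/-- Definiteness of the metric makes the solution of the defining identity unique, so exhibiting one
solution identifies the `epsilon` choice. -/
theorem christoffel_eq {x u v c : N.carrier} (hc : ∀ w : N.carrier,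
    2 * N.metric x c w = fderiv ℝ (fun y => N.metric y v w) x u
      + fderiv ℝ (fun y => N.metric y u w) x v - fderiv ℝ (fun y => N.metric y u v) x w) :
    christoffel N.metric x u v = c := by
  have h : ∀ w : N.carrier, 2 * N.metric x (christoffel N.metric x u v) w =
      fderiv ℝ (fun y => N.metric y v w) x u
      + fderiv ℝ (fun y => N.metric y u w) x v - fderiv ℝ (fun y => N.metric y u v) x w :=
    Classical.epsilon_spec (p := fun c : N.carrier => ∀ w : N.carrier,
      2 * N.metric x c w = fderiv ℝ (fun y => N.metric y v w) x u
      + fderiv ℝ (fun y => N.metric y u w) x v - fderiv ℝ (fun y => N.metric y u v) x w) ⟨c, hc⟩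
  rw [← sub_eq_zero]
  apply N.eq_zero_of_metric_self (x := x)
  have h1 := (h (christoffel N.metric x u v - c)).trans (hc _).symm
  rw [metric_eq, metric_eq] at h1
  rw [metric_eq]
  have h2 : christoffel N.metric x u v - c
      - (1 / 2 : ℝ) • N.bracket x (christoffel N.metric x u v - c)
      = (christoffel N.metric x u v - (1 / 2 : ℝ) • N.bracket x (christoffel N.metric x u v))
        - (c - (1 / 2 : ℝ) • N.bracket x c) := by
    rw [map_sub, smul_sub]; abel
  conv_lhs => arg 2; rw [h2]
  rw [inner_sub_left]
  linarith

theorem hasFDerivAt_metric (x u v : N.carrier) :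
    HasFDerivAt (fun y => N.metric y u v)
      (LinearMap.toContinuousLinearMap (
        (innerₗ N.carrier (u - (1 / 2 : ℝ) • N.bracket x u)) ∘ₗ ((-(1 / 2) : ℝ) • N.bracket.flip v)
        + (innerₗ N.carrier (v - (1 / 2 : ℝ) • N.bracket x v))
          ∘ₗ ((-(1 / 2) : ℝ) • N.bracket.flip u))) x := by
  have h (u : N.carrier) : HasFDerivAt (fun y => u - (1 / 2 : ℝ) • N.bracket y u)
      (-((1 / 2 : ℝ) • LinearMap.toContinuousLinearMap (N.bracket.flip u))) x :=
    ((LinearMap.toContinuousLinearMap (N.bracket.flip u)).hasFDerivAt.const_smul _).const_sub u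
  have h3 := (h u).inner ℝ (h v)
  simp only [metric_eq]
  refine h3.congr_fderiv ?_
  ext w
  simp only [ContinuousLinearMap.comp_apply, ContinuousLinearMap.prod_apply, fderivInnerCLM_apply,
    neg_apply, smul_apply,
    LinearMap.coe_toContinuousLinearMap', LinearMap.flip_apply, LinearMap.add_apply,
    LinearMap.comp_apply, LinearMap.smul_apply, innerₗ_apply_apply, inner_neg_left, inner_neg_right,
    inner_smul_left, inner_smul_right]
  rw [real_inner_comm (v - (1 / 2 : ℝ) • N.bracket x v) (N.bracket w u)]
  simp

theorem fderiv_metric (x u v w : N.carrier) :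
    fderiv ℝ (fun y => N.metric y u v) x w =
      -(1 / 2) * inner ℝ (u - (1 / 2 : ℝ) • N.bracket x u) (N.bracket w v)
      -(1 / 2) * inner ℝ (v - (1 / 2 : ℝ) • N.bracket x v) (N.bracket w u) := by
  rw [(N.hasFDerivAt_metric x u v).fderiv]
  simp only [LinearMap.coe_toContinuousLinearMap', LinearMap.add_apply, LinearMap.comp_apply,
    LinearMap.smul_apply, LinearMap.flip_apply, innerₗ_apply_apply, inner_smul_right]
  ring

/-- The Christoffel symbols at points of the commutator ideal. -/
theorem christoffel_of_mem_derived {x : N.carrier} (hx : x ∈ N.derived) (u v : N.carrier) :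
    christoffel N.metric x u v = -(1 / 2 : ℝ) • (N.jMap v u + N.jMap u v) := by
  refine N.christoffel_eq fun w => ?_
  rw [fderiv_metric, fderiv_metric, fderiv_metric, metric_eq]
  simp only [N.bracket_derived hx, smul_zero, sub_zero, inner_smul_left, inner_add_left, inner_jMap]
  rw [N.bracket_skew v u, N.bracket_skew w u, N.bracket_skew w v]
  simp only [inner_neg_right]
  simp
  ring

theorem christoffel_zero_right (x u : N.carrier) : christoffel N.metric x u 0 = 0 := by
  refine N.christoffel_eq fun w => ?_
  rw [fderiv_metric, fderiv_metric, fderiv_metric, metric_eq]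
  simp

theorem metric_add_derived {Z : N.carrier} (hZ : Z ∈ N.derived) (x u v : N.carrier) :
    N.metric (x + Z) u v = N.metric x u v := by
  rw [metric_eq, metric_eq, map_add, LinearMap.add_apply, LinearMap.add_apply,
    N.bracket_derived hZ, N.bracket_derived hZ, add_zero, add_zero]

/-- Translation by a central element changes neither the metric nor its derivatives in the chart. -/
theorem christoffel_add_derived {Z : N.carrier} (hZ : Z ∈ N.derived) (x u v : N.carrier) :
    christoffel N.metric (x + Z) u v = christoffel N.metric x u v := by
  unfold christoffel
  congr 1
  funext c
  simp only [fderiv_metric, metric_add_derived N hZ]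
  simp only [map_add, LinearMap.add_apply, N.bracket_derived hZ, add_zero]

theorem christoffel_derived_self {Z : N.carrier} (hZ : Z ∈ N.derived) (x : N.carrier) :
    christoffel N.metric x Z Z = 0 := by
  refine N.christoffel_eq fun w => ?_
  rw [fderiv_metric, fderiv_metric, metric_eq]
  simp [N.bracket_derived hZ, N.bracket_derived_right hZ]

/-- No differentiability is needed: where it fails, `fderiv` is `0` by convention. This avoids
proving smoothness of the Christoffel symbols. -/
theorem fderiv_eq_zero_of_translation {E F : Type*} [NormedAddCommGroup E] [NormedSpace ℝ E]
    [NormedAddCommGroup F] [NormedSpace ℝ F] {f : E → F} {x Z : E}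
    (h : ∀ s : ℝ, f (x + s • Z) = f x) : fderiv ℝ f x Z = 0 := by
  by_cases hf : DifferentiableAt ℝ f x
  · rw [← hf.lineDeriv_eq_fderiv, lineDeriv]
    simp [h]
  · rw [fderiv_zero_of_not_differentiableAt hf]; rfl

/-- Both derivative terms vanish, because `Γ(Z, Z) = 0` everywhere and `Γ` is constant in the
direction `Z`. Of the quadratic terms only `-Γ(Z, Γ(u, Z))` survives, with `Γ(u, Z) = -j(Z)u / 2`.
-/
theorem curvatureTensor_derived {x Z : N.carrier} (hx : x ∈ N.derived) (hZ : Z ∈ N.derived)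
    (u : N.carrier) :
    curvatureTensor N.metric x u Z Z = -(1 / 4 : ℝ) • N.jMap Z (N.jMap Z u) := by
  unfold curvatureTensor
  rw [fderiv_eq_zero_of_translation (f := fun y => christoffel N.metric y u Z) (Z := Z)
    fun s => N.christoffel_add_derived (N.derived.smul_mem s hZ) x u Z]
  simp only [christoffel_derived_self N hZ, christoffel_zero_right]
  simp only [N.christoffel_of_mem_derived hx, N.jMap_derived_right hZ]
  simp [smul_smul]
  norm_num

theorem geodesic_mem {Z : N.carrier} (hZ : Z ∈ N.derived) (t : ℝ) : N.geodesic Z t ∈ N.derived :=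
  N.derived.smul_mem t hZ

theorem deriv_geodesic (Z : N.carrier) (t : ℝ) : deriv (N.geodesic Z) t = Z := by
  have h : HasDerivAt (fun t : ℝ => t • Z) ((1 : ℝ) • Z) t := (hasDerivAt_id t).smul_const Z
  rw [one_smul] at h
  exact h.deriv

theorem covDerivAlong_geodesic {Z : N.carrier} (hZ : Z ∈ N.derived) (Y : ℝ → N.carrier) (t : ℝ) :
    covDerivAlong N.metric (N.geodesic Z) Y t = deriv Y t - (1 / 2 : ℝ) • N.jMap Z (Y t) := by
  rw [covDerivAlong, deriv_geodesic, N.christoffel_of_mem_derived (N.geodesic_mem hZ t),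
    N.jMap_derived_right hZ, zero_add, neg_smul, ← sub_eq_add_neg]

/-- The Jacobi equation along `exp(tZ)` is `Y'' = j(Z)Y'`. -/
theorem isJacobiField_iff {Z : N.carrier} (hZ : Z ∈ N.derived) (Y : ℝ → N.carrier) :
    IsJacobiField N.metric (N.geodesic Z) Y ↔
      ContDiff ℝ ∞ Y ∧ ∀ t, deriv (deriv Y) t = N.jMap Z (deriv Y t) := by
  refine and_congr_right fun hY => forall_congr' fun t => ?_
  have hY1 : ContDiff ℝ 1 (deriv Y) := (contDiff_infty_iff_deriv.1 hY).2.of_le (by norm_cast)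
  have h1 : covDerivAlong N.metric (N.geodesic Z) Y
      = fun t => deriv Y t - (1 / 2 : ℝ) • LinearMap.toContinuousLinearMap (N.jMap Z) (Y t) :=
    funext fun t => N.covDerivAlong_geodesic hZ Y t
  have hd : HasDerivAt (covDerivAlong N.metric (N.geodesic Z) Y)
      (deriv (deriv Y) t - (1 / 2 : ℝ) • N.jMap Z (deriv Y t)) t := by
    rw [h1]
    refine (hY1.differentiable one_ne_zero t).hasDerivAt.sub (HasDerivAt.const_smul _ ?_)
    exact (LinearMap.toContinuousLinearMap (N.jMap Z)).hasFDerivAt.comp_hasDerivAt t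
      ((hY.differentiable (by simp)) t).hasDerivAt
  rw [N.covDerivAlong_geodesic hZ (covDerivAlong N.metric (N.geodesic Z) Y), hd.deriv,
    N.covDerivAlong_geodesic hZ, deriv_geodesic, N.curvatureTensor_derived (N.geodesic_mem hZ t) hZ,
    ← sub_eq_zero (a := deriv (deriv Y) t)]
  have h2 : deriv (deriv Y) t - (1 / 2 : ℝ) • N.jMap Z (deriv Y t)
      - (1 / 2 : ℝ) • N.jMap Z (deriv Y t - (1 / 2 : ℝ) • N.jMap Z (Y t))
      + -(1 / 4 : ℝ) • N.jMap Z (N.jMap Z (Y t))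
      = deriv (deriv Y) t - N.jMap Z (deriv Y t) := by
    simp only [map_sub, map_smul]
    module
  rw [h2]

end MetricLieAlgebra

/-! ### Zeros of the solutions of `Y'' = JY'` for skew `J` -/

/-- The positive frequencies `θ` of a skew symmetric map `J`: the numbers `θ > 0` for which
`-θ²` is an eigenvalue of `J²`. -/
def frequencies {E : Type*} [AddCommGroup E] [Module ℝ E] (J : E →ₗ[ℝ] E) : Set ℝ :=
  {θ | 0 < θ ∧ ∃ w, w ≠ 0 ∧ J (J w) = -(θ ^ 2) • w}

section Skew

variable {E : Type*} [NormedAddCommGroup E] [InnerProductSpace ℝ E] {J : E →ₗ[ℝ] E}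

/-- On the `J`-invariant span of `w` and `Jw`, the field is the integral from `0` of `exp(sJ)w`. It
has period `2π/θ` and initial velocity `w`. -/
theorem exists_field_of_frequency {θ : ℝ} (hθ : θ ∈ frequencies J) (k : ℕ) :
    ∃ Y : ℝ → E, ContDiff ℝ ∞ Y ∧ (∀ t, deriv (deriv Y) t = J (deriv Y t)) ∧ Y ≠ 0 ∧ Y 0 = 0 ∧
      Y (2 * Real.pi * k / θ) = 0 := by
  obtain ⟨h0, w, hw, hJ⟩ := hθ
  have hne := h0.ne'
  have h1 (s : ℝ) : HasDerivAt (fun s => (Real.sin (θ * s) / θ) • w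
      + ((1 - Real.cos (θ * s)) / θ ^ 2) • J w)
      (Real.cos (θ * s) • w + (Real.sin (θ * s) / θ) • J w) s := by
    have hl : HasDerivAt (fun s => θ * s) θ s := by simpa using (hasDerivAt_id s).const_mul θ
    have ha := ((hl.sin.div_const θ).smul_const w).add
      (((hl.cos.const_sub 1).div_const (θ ^ 2)).smul_const (J w))
    refine HasDerivAt.congr_deriv ha ?_
    congr 2 <;> field_simp
  have h2 (s : ℝ) : HasDerivAt (fun s => Real.cos (θ * s) • w + (Real.sin (θ * s) / θ) • J w)
      (J (Real.cos (θ * s) • w + (Real.sin (θ * s) / θ) • J w)) s := by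
    have hl : HasDerivAt (fun s => θ * s) θ s := by simpa using (hasDerivAt_id s).const_mul θ
    have ha := (hl.cos.smul_const w).add ((hl.sin.div_const θ).smul_const (J w))
    refine HasDerivAt.congr_deriv ha ?_
    rw [map_add, map_smul, map_smul, hJ, add_comm, smul_smul]
    congr 2 <;> field_simp
  have hd := deriv_eq h1
  refine ⟨fun s => (Real.sin (θ * s) / θ) • w + ((1 - Real.cos (θ * s)) / θ ^ 2) • J w,
    ?_, ?_, ?_, ?_, ?_⟩
  · fun_prop
  · intro t
    rw [hd]
    exact (h2 t).deriv
  · intro h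
    have h3 := (h1 0).deriv
    rw [h] at h3
    apply hw
    simpa using h3.symm
  · simp
  · have : θ * (2 * Real.pi * k / θ) = k * (2 * Real.pi) := by field_simp
    simp only [this, Real.cos_nat_mul_two_pi]
    have h4 : Real.sin (k * (2 * Real.pi)) = 0 := by
      have := Real.sin_nat_mul_pi (2 * k)
      rw [← this]; congr 1; push_cast; ring
    rw [h4]
    simp

/-- The vector `(u, v/θ)` rotates at angular speed `θ`; the two conserved quantities express this.
If it is nonzero and returns at time `t`, the rotation by `θt` is trivial. -/
theorem harmonic_periodic {u v : ℝ → ℝ} {θ t : ℝ} (hθ : 0 < θ)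
    (hu : ∀ s, HasDerivAt u (v s) s) (hv : ∀ s, HasDerivAt v (-(θ ^ 2) * u s) s)
    (h0 : u t = u 0) (h1 : v t = v 0) : (∀ s, u s = 0) ∨ Real.cos (θ * t) = 1 := by
  have hl (s : ℝ) : HasDerivAt (fun s => θ * s) θ s := by simpa using (hasDerivAt_id s).const_mul θ
  have hp (s : ℝ) : HasDerivAt (fun s => u s * Real.cos (θ * s) - v s / θ * Real.sin (θ * s)) 0 s := by
    have := ((hu s).mul (hl s).cos).sub (((hv s).div_const θ).mul (hl s).sin)
    refine HasDerivAt.congr_deriv this ?_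
    field_simp
    ring
  have hq (s : ℝ) : HasDerivAt (fun s => u s * Real.sin (θ * s) + v s / θ * Real.cos (θ * s)) 0 s := by
    have := ((hu s).mul (hl s).sin).add (((hv s).div_const θ).mul (hl s).cos)
    refine HasDerivAt.congr_deriv this ?_
    field_simp
    ring
  have cp (s : ℝ) := is_const_of_deriv_eq_zero (fun s => (hp s).differentiableAt)
    (fun s => (hp s).deriv) s 0
  have cq (s : ℝ) := is_const_of_deriv_eq_zero (fun s => (hq s).differentiableAt)
    (fun s => (hq s).deriv) s 0
  simp only [mul_zero, Real.cos_zero, Real.sin_zero, mul_one, sub_zero, zero_add] at cp cq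
  by_cases h : u 0 ^ 2 + (v 0 / θ) ^ 2 = 0
  · left
    intro s
    have ha : u 0 = 0 := by nlinarith [sq_nonneg (u 0), sq_nonneg (v 0 / θ)]
    have hb : v 0 / θ = 0 := by nlinarith [sq_nonneg (u 0), sq_nonneg (v 0 / θ)]
    have e1 := cp s
    have e2 := cq s
    rw [ha] at e1
    rw [hb] at e2
    calc u s = u s * (Real.sin (θ * s) ^ 2 + Real.cos (θ * s) ^ 2) := by
          rw [Real.sin_sq_add_cos_sq, mul_one]
      _ = (u s * Real.cos (θ * s) - v s / θ * Real.sin (θ * s)) * Real.cos (θ * s)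
          + (u s * Real.sin (θ * s) + v s / θ * Real.cos (θ * s)) * Real.sin (θ * s) := by ring
      _ = 0 := by rw [e1, e2]; ring
  · right
    have e1 := cp t
    have e2 := cq t
    rw [h0, h1] at e1 e2
    apply mul_left_cancel₀ h
    linear_combination u 0 * e1 + (v 0 / θ) * e2

theorem exists_frequency_of_field [FiniteDimensional ℝ E]
    (hJ : ∀ x y, inner ℝ (J x) y = - inner ℝ x (J y))
    {Y : ℝ → E} (hY : ContDiff ℝ ∞ Y) (hode : ∀ t, deriv (deriv Y) t = J (deriv Y t))
    (hne : Y ≠ 0) (h0 : Y 0 = 0) {t : ℝ} (ht : 0 < t) (h1 : Y t = 0) :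
    ∃ θ ∈ frequencies J, ∃ k : ℕ, 1 ≤ k ∧ t = 2 * Real.pi * k / θ := by
  have hsymm : (J ∘ₗ J).IsSymmetric := by
    intro x y
    simp only [LinearMap.comp_apply, hJ, neg_neg]
  set b := hsymm.eigenvectorBasis rfl with hb
  have hdY (s : ℝ) : HasDerivAt Y (deriv Y s) s :=
    ((hY.differentiable (by simp)) s).hasDerivAt
  have hY1 : ContDiff ℝ 1 (deriv Y) := (contDiff_infty_iff_deriv.1 hY).2.of_le (by norm_cast)
  have hdY1 (s : ℝ) : HasDerivAt (deriv Y) (J (deriv Y s)) s := by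
    rw [← hode]
    exact (hY1.differentiable one_ne_zero s).hasDerivAt
  have hcont (s : ℝ) : HasDerivAt (fun s => J (Y s)) (J (deriv Y s)) s :=
    (LinearMap.toContinuousLinearMap J).hasFDerivAt.comp_hasDerivAt s (hdY s)
  have hJd (s : ℝ) : HasDerivAt (fun s => J (deriv Y s)) (J (J (deriv Y s))) s :=
    (LinearMap.toContinuousLinearMap J).hasFDerivAt.comp_hasDerivAt s (hdY1 s)
  -- `Y' - JY` is a first integral, so the zeros of `Y` at `0` and `t` force `Y'(t) = Y'(0)`.
  have hint (s : ℝ) : deriv Y s - J (Y s) = deriv Y 0 - J (Y 0) :=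
    is_const_of_deriv_eq_zero (f := fun s => deriv Y s - J (Y s))
      (fun s => ((hdY1 s).sub (hcont s)).differentiableAt)
      (fun s => ((hdY1 s).sub (hcont s)).deriv.trans (sub_self _)) s 0
  have hper : deriv Y t = deriv Y 0 := by
    have := hint t
    rwa [h0, h1, map_zero, sub_zero, sub_zero] at this
  have hin (i) {f : ℝ → E} {f' : E} {s : ℝ} (hf : HasDerivAt f f' s) :
      HasDerivAt (fun s => inner ℝ (b i) (f s)) (inner ℝ (b i) f') s :=
    (innerSL ℝ (b i)).hasFDerivAt.comp_hasDerivAt s hf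
  obtain ⟨i, hi⟩ : ∃ i, ¬ ∀ s, inner ℝ (b i) (Y s) = 0 := by
    by_contra! hall
    apply hne
    funext s
    rw [← b.sum_repr' (Y s)]
    simp [hall]
  have hbi : J (J (b i)) = hsymm.eigenvalues rfl i • b i := hsymm.apply_eigenvectorBasis rfl i
  set μ := hsymm.eigenvalues rfl i
  have hb1 : inner ℝ (b i) (b i) = (1 : ℝ) := by
    rw [real_inner_self_eq_norm_sq, b.norm_eq_one]; norm_num
  have hμ : μ = - inner ℝ (J (b i)) (J (b i)) := by
    have := hJ (J (b i)) (b i)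
    rw [hbi, inner_smul_left, hb1] at this
    simpa using this
  have hui (s : ℝ) : inner ℝ (b i) (J (J (deriv Y s))) = μ * inner ℝ (b i) (deriv Y s) := by
    rw [← neg_neg (inner ℝ (b i) _), ← hJ, ← inner_neg_right, ← map_neg, ← neg_neg (inner ℝ _ _),
      ← hJ, ← inner_neg_left, hbi]
    simp [inner_smul_left]
  rcases eq_or_lt_of_le (show μ ≤ 0 by rw [hμ]; simp) with hμ0 | hμ0
  -- Along the kernel of `J` the component of `Y` is a multiple of `s`; its zero at `t > 0` makes it
  -- vanish identically.
  · exfalso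
    have hJb : J (b i) = 0 := by
      rw [hμ0] at hμ
      rw [← inner_self_eq_zero (𝕜 := ℝ)]; linarith
    have hc (s : ℝ) : inner ℝ (b i) (deriv Y s) = inner ℝ (b i) (deriv Y 0) := by
      refine is_const_of_deriv_eq_zero (f := fun s => inner ℝ (b i) (deriv Y s))
        (fun s => (hin i (hdY1 s)).differentiableAt) (fun s => ?_) s 0
      rw [(hin i (hdY1 s)).deriv, ← neg_neg (inner ℝ _ _), ← hJ, hJb, inner_zero_left, neg_zero]
    have hc2 (s : ℝ) : inner ℝ (b i) (Y s) - s * inner ℝ (b i) (deriv Y 0) = 0 := by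
      have hd (s : ℝ) : HasDerivAt (fun s => inner ℝ (b i) (Y s) - s * inner ℝ (b i) (deriv Y 0))
          0 s := by
        have := (hin i (hdY s)).sub ((hasDerivAt_id s).mul_const (inner ℝ (b i) (deriv Y 0)))
        rwa [hc s, one_mul, sub_self] at this
      have := is_const_of_deriv_eq_zero (fun s => (hd s).differentiableAt)
        (fun s => (hd s).deriv) s 0
      rw [this, h0]
      simp
    have hz : inner ℝ (b i) (deriv Y 0) = (0 : ℝ) := by
      have := hc2 t
      rw [h1, inner_zero_right, zero_sub, neg_eq_zero] at this
      exact (mul_eq_zero.1 this).resolve_left ht.ne'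
    apply hi
    intro s
    have := hc2 s
    rwa [hz, mul_zero, sub_zero] at this
  -- For `μ < 0` the components of `Y'` and `JY'` along `b i` form a harmonic pair with frequency
  -- `√(-μ)` that returns at `t`.
  · have hθ : 0 < √(-μ) := Real.sqrt_pos.2 (by linarith)
    have hθ2 : √(-μ) ^ 2 = -μ := Real.sq_sqrt (by linarith)
    refine ⟨√(-μ), ⟨hθ, b i, ?_, ?_⟩, ?_⟩
    · intro h
      rw [h, inner_zero_left] at hb1
      exact zero_ne_one hb1
    · rw [hθ2, neg_neg, hbi]
    · rcases harmonic_periodic (t := t) hθ (fun s => hin i (hdY1 s))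
        (fun s => by rw [hθ2, neg_neg, ← hui]; exact hin i (hJd s))
        (by rw [hper]) (by rw [hper]) with h | h
      · exfalso
        apply hi
        intro s
        have := is_const_of_deriv_eq_zero (f := fun s => inner ℝ (b i) (Y s))
          (fun s => (hin i (hdY s)).differentiableAt)
          (fun s => by rw [(hin i (hdY s)).deriv, h]) s 0
        rw [this, h0, inner_zero_right]
      · obtain ⟨n, hn⟩ := (Real.cos_eq_one_iff _).1 h
        have hpos : 0 < (n : ℝ) * (2 * Real.pi) := by rw [hn]; positivity
        have hn0 : 0 < n := by
          have := pos_of_mul_pos_left hpos (by positivity)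
          exact_mod_cast this
        lift n to ℕ using hn0.le
        refine ⟨n, by exact_mod_cast hn0, ?_⟩
        rw [eq_div_iff hθ.ne', mul_comm, ← hn]
        push_cast
        ring

end Skew

/-! ### Counting primitive conjugate values -/

/-- If no frequency is an integer multiple of another one, then the primitive elements among the
numbers `2πk/θ` are the numbers `2π/θ`. -/
theorem encard_primitive {S : Set ℝ} (hpos : ∀ θ ∈ S, 0 < θ)
    (hS : ∀ θ ∈ S, ∀ θ' ∈ S, ∀ m : ℕ, 2 ≤ m → θ' ≠ m * θ) {T : Set ℝ}
    (hT : ∀ t, t ∈ T ↔ ∃ θ ∈ S, ∃ k : ℕ, 1 ≤ k ∧ t = 2 * Real.pi * k / θ) :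
    {t : ℝ | t ∈ T ∧ ¬ ∃ m : ℕ, 2 ≤ m ∧ ∃ t₀ : ℝ, t₀ ∈ T ∧ t = m * t₀}.encard = S.encard := by
  have : {t : ℝ | t ∈ T ∧ ¬ ∃ m : ℕ, 2 ≤ m ∧ ∃ t₀ : ℝ, t₀ ∈ T ∧ t = m * t₀}
      = (fun θ => 2 * Real.pi / θ) '' S := by
    ext t
    constructor
    · rintro ⟨h1, h2⟩
      obtain ⟨θ, hθ, k, hk, rfl⟩ := (hT t).1 h1
      rcases hk.eq_or_lt with rfl | hk
      · exact ⟨θ, hθ, by simp⟩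
      · exact absurd ⟨k, hk, 2 * Real.pi / θ, (hT _).2 ⟨θ, hθ, 1, le_rfl, by simp⟩, by ring⟩ h2
    · rintro ⟨θ, hθ, rfl⟩
      refine ⟨(hT _).2 ⟨θ, hθ, 1, le_rfl, by simp⟩, ?_⟩
      rintro ⟨m, hm, t₀, ht₀, h⟩
      obtain ⟨θ', hθ', k, hk, rfl⟩ := (hT t₀).1 ht₀
      -- `2π/θ = m · 2πk/θ'` means `θ' = (mk)θ`, a resonance since `mk ≥ 2`.
      refine hS θ hθ θ' hθ' (m * k) (by nlinarith) ?_
      have := hpos θ hθ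
      have := hpos θ' hθ'
      have := Real.pi_pos
      push_cast
      field_simp at h
      linarith
  rw [this, Set.InjOn.encard_image]
  intro a ha b hb h
  have := hpos a ha
  have := hpos b hb
  have := Real.pi_pos
  simp only at h
  field_simp at h
  exact h.symm

/-- There are exactly `P` frequencies, and none is a proper integer multiple of another one. -/
def NonResonant {E : Type*} [AddCommGroup E] [Module ℝ E] (P : ℕ) (J : E →ₗ[ℝ] E) : Prop :=
  (frequencies J).encard = P ∧
    ∀ θ ∈ frequencies J, ∀ θ' ∈ frequencies J, ∀ m : ℕ, 2 ≤ m → θ' ≠ m * θ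

namespace MetricLieAlgebra

variable {p q : ℕ} (N : MetricLieAlgebra p q)

theorem isConjugateValue_iff {Z : N.carrier} (hZ : Z ∈ N.derived) (t : ℝ) :
    N.IsConjugateValue Z t ↔
      ∃ θ ∈ frequencies (N.jMap Z), ∃ k : ℕ, 1 ≤ k ∧ t = 2 * Real.pi * k / θ := by
  constructor
  · rintro ⟨ht, Y, hY, hne, h0, h1⟩
    obtain ⟨hs, hode⟩ := (N.isJacobiField_iff hZ Y).1 hY
    exact exists_frequency_of_field (N.inner_jMap_skew Z) hs hode hne h0 ht h1
  · rintro ⟨θ, hθ, k, hk, rfl⟩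
    have hk' : (0 : ℝ) < k := by exact_mod_cast hk
    refine ⟨div_pos (mul_pos Real.two_pi_pos hk') hθ.1, ?_⟩
    obtain ⟨Y, hs, hode, hne, h0, h1⟩ := exists_field_of_frequency hθ k
    exact ⟨Y, (N.isJacobiField_iff hZ Y).2 ⟨hs, hode⟩, hne, h0, h1⟩

theorem encard_primitive_of_nonResonant {Z : N.carrier} (hZ : Z ∈ N.derived) {P : ℕ}
    (h : NonResonant P (N.jMap Z)) :
    {t : ℝ | N.IsPrimitiveConjugateValue Z t}.encard = P := by
  rw [← h.1]
  exact encard_primitive (T := {t | N.IsConjugateValue Z t}) (fun θ hθ => hθ.1) h.2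
    (fun t => N.isConjugateValue_iff hZ t)

end MetricLieAlgebra

/-! ### Nonresonance in terms of resultants -/

section ReducedCharpoly

open Polynomial Matrix

variable {q : ℕ} {R S : Type*} [CommRing R] [CommRing S]

/-- The monic polynomial `ρ` of degree `⌊q/2⌋` with `χ_M = X^(q mod 2) ρ(X²)` for a skew symmetric
`q × q` matrix `M`. -/
def reducedCharpoly (M : Matrix (Fin q) (Fin q) R) : R[X] :=
  X ^ (q / 2) + ∑ k ∈ Finset.range (q / 2), C (M.charpoly.coeff (2 * k + q % 2)) * X ^ k

theorem reducedCharpoly_map (M : Matrix (Fin q) (Fin q) R) (f : R →+* S) :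
    reducedCharpoly (M.map f) = (reducedCharpoly M).map f := by
  simp [reducedCharpoly, Polynomial.map_sum, Matrix.charpoly_map]

theorem degree_reducedCharpoly_sum_lt (M : Matrix (Fin q) (Fin q) R) :
    (∑ k ∈ Finset.range (q / 2), C (M.charpoly.coeff (2 * k + q % 2)) * X ^ k).degree
      < ((q / 2 : ℕ) : WithBot ℕ) := by
  refine (degree_sum_le _ _).trans_lt ((Finset.sup_lt_iff (WithBot.bot_lt_coe _)).2 fun k hk => ?_)
  exact (degree_C_mul_X_pow_le _ _).trans_lt (by exact_mod_cast Finset.mem_range.1 hk)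

theorem reducedCharpoly_monic (M : Matrix (Fin q) (Fin q) R) : (reducedCharpoly M).Monic :=
  monic_X_pow_add (degree_reducedCharpoly_sum_lt M)

theorem natDegree_reducedCharpoly [Nontrivial R] (M : Matrix (Fin q) (Fin q) R) :
    (reducedCharpoly M).natDegree = q / 2 := by
  rw [reducedCharpoly, natDegree_add_eq_left_of_degree_lt, natDegree_X_pow]
  rw [degree_X_pow]
  exact degree_reducedCharpoly_sum_lt M

/-- The formula extends past the coefficients used in the definition: at `k = q / 2` the index `2k +
q % 2` equals `q`, and both polynomials are monic. -/
theorem coeff_reducedCharpoly [Nontrivial R] (M : Matrix (Fin q) (Fin q) R) (k : ℕ) :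
    (reducedCharpoly M).coeff k = M.charpoly.coeff (2 * k + q % 2) := by
  rcases lt_trichotomy k (q / 2) with h | h | h
  · simp [reducedCharpoly, coeff_X_pow, h.ne, h]
  · subst h
    have h1 := (reducedCharpoly_monic M).coeff_natDegree
    have h2 := M.charpoly_monic.coeff_natDegree
    rw [natDegree_reducedCharpoly] at h1
    rw [Matrix.charpoly_natDegree_eq_dim, Fintype.card_fin] at h2
    rw [h1, Nat.div_add_mod, h2]
  · rw [coeff_eq_zero_of_natDegree_lt, coeff_eq_zero_of_natDegree_lt]
    · rw [Matrix.charpoly_natDegree_eq_dim, Fintype.card_fin]; omega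
    · rwa [natDegree_reducedCharpoly]

/-- The resultant of `ρ` and `ρ'`. -/
def reducedDisc (M : Matrix (Fin q) (Fin q) R) : R :=
  resultant (reducedCharpoly M) (derivative (reducedCharpoly M)) (q / 2) (q / 2)

/-- The resultant of `ρ` and of the polynomial whose roots are those of `ρ` multiplied by `ε`. -/
def reducedRes (M : Matrix (Fin q) (Fin q) R) (ε : R) : R :=
  resultant (reducedCharpoly M) ((reducedCharpoly M).scaleRoots ε) (q / 2) (q / 2)

/-- The formal degrees of the resultant are fixed at `q / 2`, so it commutes with ring homomorphisms
whatever the actual degree of the derivative. -/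
theorem reducedDisc_map (M : Matrix (Fin q) (Fin q) R) (f : R →+* S) :
    reducedDisc (M.map f) = f (reducedDisc M) := by
  rw [reducedDisc, reducedCharpoly_map, derivative_map, resultant_map_map, reducedDisc]

theorem reducedRes_map [Nontrivial S] (M : Matrix (Fin q) (Fin q) R) (ε : R) (f : R →+* S) :
    reducedRes (M.map f) (f ε) = f (reducedRes M ε) := by
  rw [reducedRes, reducedCharpoly_map, ← map_scaleRoots, resultant_map_map, reducedRes]
  rw [(reducedCharpoly_monic M).leadingCoeff, map_one]
  exact one_ne_zero

variable {A : Matrix (Fin q) (Fin q) ℝ}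

theorem charpoly_eval_neg (hA : Aᵀ = -A) (x : ℝ) :
    A.charpoly.eval (-x) = (-1) ^ q * A.charpoly.eval x := by
  rw [eval_charpoly, eval_charpoly, ← det_transpose]
  have : (scalar (Fin q) (-x) - A)ᵀ = -(scalar (Fin q) x - A) := by
    rw [transpose_sub, hA]
    simp only [scalar_apply, diagonal_transpose]
    rw [neg_sub, sub_neg_eq_add, ← diagonal_neg]
    abel
  rw [this, det_neg, Fintype.card_fin]

theorem charpoly_comp_neg (hA : Aᵀ = -A) :
    A.charpoly.comp (-X) = C ((-1) ^ q) * A.charpoly :=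
  Polynomial.funext fun x => by
    rw [eval_comp, eval_neg, eval_X, charpoly_eval_neg hA, eval_mul, eval_C]

theorem charpoly_coeff_eq_zero (hA : Aᵀ = -A) {j : ℕ} (hj : j % 2 ≠ q % 2) :
    A.charpoly.coeff j = 0 := by
  have h := congrArg (fun f => coeff f j) (charpoly_comp_neg hA)
  have h2 : (A.charpoly.comp (-X)).coeff j = (-1) ^ j * A.charpoly.coeff j := by
    have : (-X : ℝ[X]) = C (-1) * X := by simp
    rw [this, comp_C_mul_X_coeff, mul_comm]
  simp only [h2, coeff_C_mul] at h
  rcases Nat.even_or_odd j with ej | oj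
  · have hq : Odd q := by
      rw [Nat.odd_iff]; rw [Nat.even_iff] at ej; omega
    rw [ej.neg_one_pow, hq.neg_one_pow] at h
    linarith
  · have hq : Even q := by
      rw [Nat.even_iff]; rw [Nat.odd_iff] at oj; omega
    rw [oj.neg_one_pow, hq.neg_one_pow] at h
    linarith

theorem charpoly_eq_expand (hA : Aᵀ = -A) :
    A.charpoly = X ^ (q % 2) * expand ℝ 2 (reducedCharpoly A) := by
  ext j
  rw [coeff_X_pow_mul', coeff_expand two_pos, coeff_reducedCharpoly]
  split_ifs with h1 h2
  · congr 1; omega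
  · exact charpoly_coeff_eq_zero hA (by omega)
  · exact charpoly_coeff_eq_zero hA (by omega)

/-- Since `(x - A)ᵀ = x + A`, one has `det(x² - A²) = det(x - A) det(x + A) = χ_A(x)²`. The identity
then follows by cancelling the substitution `X ↦ X²`. -/
theorem charpoly_sq_eq (hA : Aᵀ = -A) :
    (A * A).charpoly = X ^ (q % 2) * reducedCharpoly A ^ 2 := by
  apply expand_injective (R := ℝ) two_pos
  have h1 : expand ℝ 2 (A * A).charpoly = A.charpoly ^ 2 := by
    refine Polynomial.funext fun x => ?_
    rw [expand_eval, eval_pow, eval_charpoly, eval_charpoly, sq (det _)]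
    nth_rw 1 [← det_transpose (scalar (Fin q) x - A)]
    rw [← det_mul]
    congr 1
    rw [transpose_sub, hA]
    simp only [scalar_apply, sub_neg_eq_add, ← smul_one_eq_diagonal, transpose_smul, transpose_one]
    simp only [add_mul, mul_sub, smul_mul_assoc, mul_smul_comm, one_mul, mul_one, smul_add,
      smul_smul, ← sq]
    abel
  rw [h1, charpoly_eq_expand hA, map_mul, map_pow, map_pow, expand_X]
  ring

theorem isRoot_charpoly_iff (M : Matrix (Fin q) (Fin q) ℝ) (μ : ℝ) :
    M.charpoly.IsRoot μ ↔ ∃ v : EuclideanSpace ℝ (Fin q), v ≠ 0 ∧ toEuclideanLin M v = μ • v := by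
  rw [IsRoot.def, eval_charpoly, ← exists_mulVec_eq_zero_iff]
  constructor
  · rintro ⟨v, hv, h⟩
    refine ⟨WithLp.toLp 2 v, by simpa using hv, ?_⟩
    rw [toLpLin_toLp, toLin'_apply, ← WithLp.toLp_smul]
    congr 1
    rw [sub_mulVec, sub_eq_zero] at h
    rw [← h]
    simp [scalar_apply, ← smul_one_eq_diagonal, smul_mulVec]
  · rintro ⟨v, hv, h⟩
    refine ⟨WithLp.ofLp v, by simpa using hv, ?_⟩
    have h' := congrArg WithLp.ofLp h
    rw [ofLp_toLpLin, toLin'_apply, WithLp.ofLp_smul] at h'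
    rw [sub_mulVec, h', sub_eq_zero]
    simp [scalar_apply, ← smul_one_eq_diagonal, smul_mulVec]

theorem toEuclideanLin_sq (M : Matrix (Fin q) (Fin q) ℝ) (v : EuclideanSpace ℝ (Fin q)) :
    toEuclideanLin (M * M) v = toEuclideanLin M (toEuclideanLin M v) := by
  simp [toLpLin_apply, mulVec_mulVec]

theorem mem_frequencies_iff (hA : Aᵀ = -A) {θ : ℝ} (hθ : 0 < θ) :
    θ ∈ frequencies (toEuclideanLin A) ↔ (reducedCharpoly A).eval (-(θ ^ 2)) = 0 := by
  have h := isRoot_charpoly_iff (A * A) (-(θ ^ 2))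
  simp only [toEuclideanLin_sq] at h
  rw [charpoly_sq_eq hA, IsRoot.def, eval_mul, eval_pow, eval_pow, eval_X, mul_eq_zero,
    or_iff_right (pow_ne_zero _ (by nlinarith [sq_pos_of_pos hθ])), pow_eq_zero_iff two_ne_zero] at h
  rw [h]
  exact and_iff_right hθ

/-- It divides the characteristic polynomial of the symmetric matrix `A²`, which splits over `ℝ`. -/
theorem reducedCharpoly_splits (hA : Aᵀ = -A) : (reducedCharpoly A).Splits := by
  have hs : (A * A).IsHermitian := by
    rw [IsHermitian, conjTranspose_eq_transpose_of_trivial, transpose_mul, hA, neg_mul_neg]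
  refine hs.splits_charpoly.of_dvd (charpoly_monic _).ne_zero ?_
  rw [charpoly_sq_eq hA, sq]
  exact ⟨X ^ (q % 2) * reducedCharpoly A, by ring⟩

theorem nonpos_of_root (hA : Aᵀ = -A) {μ : ℝ} (h : (reducedCharpoly A).eval μ = 0) : μ ≤ 0 := by
  have h1 : (A * A).charpoly.IsRoot μ := by
    rw [charpoly_sq_eq hA, IsRoot.def, eval_mul, eval_pow (n := 2), h]; simp
  obtain ⟨v, hv, h2⟩ := (isRoot_charpoly_iff _ _).1 h1
  have h3 : inner ℝ (toEuclideanLin (A * A) v) v = - inner ℝ (toEuclideanLin A v) (toEuclideanLin A v) := by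
    rw [toEuclideanLin_sq]
    nth_rw 1 [← LinearMap.adjoint_inner_right, ← toEuclideanLin_conjTranspose_eq_adjoint,
      conjTranspose_eq_transpose_of_trivial, hA]
    rw [map_neg, LinearMap.neg_apply, inner_neg_right]
  rw [h2, inner_smul_left, real_inner_self_eq_norm_sq, real_inner_self_eq_norm_sq] at h3
  simp only [conj_trivial] at h3
  have h4 : 0 < ‖v‖ ^ 2 := by positivity
  by_contra! h5
  nlinarith [sq_nonneg ‖toEuclideanLin A v‖, mul_pos h5 h4]

theorem card_roots_reducedCharpoly (hA : Aᵀ = -A) :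
    Multiset.card (reducedCharpoly A).roots = q / 2 := by
  rw [← (reducedCharpoly_splits hA).natDegree_eq_card_roots, natDegree_reducedCharpoly]

theorem mem_roots_reducedCharpoly (A : Matrix (Fin q) (Fin q) ℝ) {μ : ℝ} :
    μ ∈ (reducedCharpoly A).roots ↔ (reducedCharpoly A).eval μ = 0 := by
  rw [mem_roots (reducedCharpoly_monic A).ne_zero, IsRoot.def]

/-- As `ρ` is monic and split, the resultant is the product of `ρ'(r)` over its roots `r`, which is
nonzero exactly when all roots are simple. -/
theorem reducedDisc_ne_zero_iff (hA : Aᵀ = -A) :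
    reducedDisc A ≠ 0 ↔ (reducedCharpoly A).roots.Nodup := by
  have hd : (derivative (reducedCharpoly A)).natDegree ≤ q / 2 :=
    (natDegree_derivative_le _).trans (by rw [natDegree_reducedCharpoly]; omega)
  have h := resultant_eq_prod_eval (reducedCharpoly A) (derivative (reducedCharpoly A)) (q / 2)
    hd (reducedCharpoly_splits hA)
  rw [natDegree_reducedCharpoly, (reducedCharpoly_monic A).leadingCoeff, one_pow, one_mul] at h
  rw [reducedDisc, h, ne_eq, Multiset.prod_eq_zero_iff, Multiset.mem_map,
    Multiset.nodup_iff_count_le_one]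
  push Not
  simp only [mem_roots_reducedCharpoly]
  have h0 := (reducedCharpoly_monic A).ne_zero
  have key (r : ℝ) := one_lt_rootMultiplicity_iff_isRoot (t := r) h0
  simp only [count_roots, IsRoot.def] at key ⊢
  refine ⟨fun h r => ?_, fun h r hr hr' => ?_⟩
  · by_contra! hlt
    exact h r ((key r).1 hlt).1 ((key r).1 hlt).2
  · exact absurd ((key r).2 ⟨hr, hr'⟩) (not_lt.2 (h r))

theorem reducedRes_ne_zero_iff (hA : Aᵀ = -A) (ε : ℝ) :
    reducedRes A ε ≠ 0 ↔ ∀ r, (reducedCharpoly A).eval r = 0 →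
      ((reducedCharpoly A).scaleRoots ε).eval r ≠ 0 := by
  have h := resultant_eq_prod_eval (reducedCharpoly A) ((reducedCharpoly A).scaleRoots ε) (q / 2)
    (by rw [natDegree_scaleRoots, natDegree_reducedCharpoly]) (reducedCharpoly_splits hA)
  rw [natDegree_reducedCharpoly, (reducedCharpoly_monic A).leadingCoeff, one_pow, one_mul] at h
  rw [reducedRes, h, ne_eq, Multiset.prod_eq_zero_iff, Multiset.mem_map]
  push Not
  simp only [mem_roots_reducedCharpoly]

theorem eval_scaleRoots_mul (f : ℝ[X]) (ε x : ℝ) :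
    (f.scaleRoots ε).eval (ε * x) = ε ^ f.natDegree * f.eval x := by
  have := scaleRoots_eval₂_mul (p := f) (RingHom.id ℝ) x ε
  simpa [eval₂_id] using this

/-- The numbers `1 / m²` with `m ≥ 2`, together with their limit `0`. -/
def resonanceScales : Set ℝ := insert 0 (Set.range fun m : ℕ => (((m : ℝ) + 2) ^ 2)⁻¹)

theorem encard_frequencies_le (hA : Aᵀ = -A) :
    (frequencies (toEuclideanLin A)).encard ≤ (q / 2 : ℕ) := by
  have hinj : Set.InjOn (fun θ : ℝ => -(θ ^ 2)) (frequencies (toEuclideanLin A)) := by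
    intro a ha b hb h
    simp only [neg_inj] at h
    exact (pow_left_inj₀ ha.1.le hb.1.le two_ne_zero).1 h
  rw [← hinj.encard_image]
  refine (Set.encard_le_encard (t := ((reducedCharpoly A).roots.toFinset : Set ℝ)) ?_).trans ?_
  · rintro _ ⟨θ, hθ, rfl⟩
    simpa [mem_roots_reducedCharpoly, -mem_roots'] using (mem_frequencies_iff hA hθ.1).1 hθ
  · rw [Set.encard_coe_eq_coe_finsetCard, ← card_roots_reducedCharpoly hA]
    exact_mod_cast Multiset.toFinset_card_le _

/-- With `μ = -θ²`, a resonance `θ' = mθ` reads `μ = μ'/m²`, so `μ` is a common root of `ρ` and of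
`ρ` scaled by `1/m²`. For `ε = 0` the scaled polynomial is a power of `X`, and the condition becomes
`ρ(0) ≠ 0`. Together with simplicity of the roots, this yields `q / 2` distinct positive
frequencies. -/
theorem nonResonant_iff (hA : Aᵀ = -A) :
    NonResonant (q / 2) (toEuclideanLin A) ↔
      reducedDisc A ≠ 0 ∧ ∀ ε ∈ resonanceScales, reducedRes A ε ≠ 0 := by
  have hinj : Set.InjOn (fun θ : ℝ => -(θ ^ 2)) (frequencies (toEuclideanLin A)) := by
    intro a ha b hb h
    simp only [neg_inj] at h
    exact (pow_left_inj₀ ha.1.le hb.1.le two_ne_zero).1 h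
  have himage : (fun θ : ℝ => -(θ ^ 2)) '' frequencies (toEuclideanLin A)
      = (((reducedCharpoly A).roots.toFinset.erase 0 : Finset ℝ) : Set ℝ) := by
    ext μ
    simp only [Set.mem_image, Finset.coe_erase, Set.mem_sdiff, Finset.mem_coe, Multiset.mem_toFinset,
      mem_roots_reducedCharpoly, Set.mem_singleton_iff]
    constructor
    · rintro ⟨θ, hθ, rfl⟩
      refine ⟨(mem_frequencies_iff hA hθ.1).1 hθ, ?_⟩
      nlinarith [sq_pos_of_pos hθ.1]
    · rintro ⟨h, h0⟩
      have hlt := lt_of_le_of_ne (nonpos_of_root hA h) h0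
      have hs : √(-μ) ^ 2 = -μ := Real.sq_sqrt (by linarith)
      refine ⟨√(-μ), (mem_frequencies_iff hA (Real.sqrt_pos.2 (by linarith))).2 ?_, ?_⟩
      · rwa [hs, neg_neg]
      · rw [hs, neg_neg]
  -- `ρ` has `q / 2` roots with multiplicity; a repetition or a root `0` would each lose a
  -- frequency.
  have hcard : (frequencies (toEuclideanLin A)).encard = (q / 2 : ℕ) ↔
      (reducedCharpoly A).roots.Nodup ∧ (reducedCharpoly A).eval 0 ≠ 0 := by
    rw [← hinj.encard_image, himage, Set.encard_coe_eq_coe_finsetCard,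
      ← card_roots_reducedCharpoly hA, Nat.cast_inj, ne_eq (eval 0 _),
      ← mem_roots_reducedCharpoly]
    constructor
    · intro h
      have h1 := Finset.card_erase_le (s := (reducedCharpoly A).roots.toFinset) (a := 0)
      have h2 := Multiset.toFinset_card_le (reducedCharpoly A).roots
      refine ⟨Multiset.toFinset_card_eq_card_iff_nodup.1 (by omega), fun h0 => ?_⟩
      have h3 := Finset.card_erase_lt_of_mem (Multiset.mem_toFinset.2 h0)
      omega
    · rintro ⟨h1, h2⟩
      rw [Finset.erase_eq_of_notMem (by rwa [Multiset.mem_toFinset])]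
      exact Multiset.toFinset_card_eq_card_iff_nodup.2 h1
  rw [NonResonant, hcard, reducedDisc_ne_zero_iff hA, and_assoc]
  refine and_congr_right fun _ => ?_
  simp only [reducedRes_ne_zero_iff hA]
  constructor
  · rintro ⟨h0, h⟩ ε (rfl | ⟨m, rfl⟩) r hr
    · intro h1
      rw [scaleRoots_zero] at h1
      simp only [eval_pow, eval_X, (reducedCharpoly_monic A).leadingCoeff,
        one_smul] at h1
      rw [eq_zero_of_pow_eq_zero h1] at hr
      exact h0 hr
    · intro h1
      have hm : (0 : ℝ) < m + 2 := by positivity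
      have hr0 : r < 0 := lt_of_le_of_ne (nonpos_of_root hA hr) (by rintro rfl; exact h0 hr)
      have hs : √(-r) ^ 2 = -r := Real.sq_sqrt (by linarith)
      have hp : 0 < √(-r) := Real.sqrt_pos.2 (by linarith)
      have e : r = (((m : ℝ) + 2) ^ 2)⁻¹ * (((m : ℝ) + 2) ^ 2 * r) := by field_simp
      rw [e, eval_scaleRoots_mul, mul_eq_zero, or_iff_right (by positivity)] at h1
      refine h (√(-r)) ((mem_frequencies_iff hA hp).2 ?_) ((m + 2 : ℕ) * √(-r))
        ((mem_frequencies_iff hA (by positivity)).2 ?_) (m + 2) (by omega) rfl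
      · rwa [hs, neg_neg]
      · rw [mul_pow, hs]
        push_cast
        rwa [mul_neg, neg_neg]
  · intro h
    constructor
    · intro h0
      refine h 0 (Set.mem_insert _ _) 0 h0 ?_
      have := eval_scaleRoots_mul (reducedCharpoly A) 0 0
      rwa [h0, zero_mul, mul_zero] at this
    · rintro θ hθ θ' hθ' m hm rfl
      obtain ⟨n, rfl⟩ := Nat.exists_eq_add_of_le' hm
      refine h ((((n : ℝ) + 2) ^ 2)⁻¹) (Set.mem_insert_of_mem _ ⟨n, rfl⟩) _
        ((mem_frequencies_iff hA hθ.1).1 hθ) ?_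
      have e : -(θ ^ 2) = (((n : ℝ) + 2) ^ 2)⁻¹ * (-((((n + 2 : ℕ) : ℝ) * θ) ^ 2)) := by
        push_cast
        field_simp
      rw [e, eval_scaleRoots_mul, (mem_frequencies_iff hA hθ'.1).1 hθ', mul_zero]

end ReducedCharpoly

/-! ### Resonant matrices: openness of the complement and intersections with lines -/

section Generic

open Polynomial Matrix

/-- Restricted to the line, `F` is a polynomial in `s` that is nonzero because its value at `s = 0`
is. -/
theorem finite_zeros_mvPolynomial_line {σ : Type*} (F : MvPolynomial σ ℝ) (a b : σ → ℝ)
    (h : MvPolynomial.eval a F ≠ 0) : {s : ℝ | MvPolynomial.eval (a + s • b) F = 0}.Finite := by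
  set f : ℝ[X] := MvPolynomial.aeval (fun i => C (a i) + X * C (b i)) F with hf
  have he (s : ℝ) : f.eval s = MvPolynomial.eval (a + s • b) F := by
    rw [hf, ← coe_evalRingHom, MvPolynomial.aeval_def, MvPolynomial.hom_eval₂, MvPolynomial.eval]
    have h1 : (evalRingHom s).comp (algebraMap ℝ ℝ[X]) = RingHom.id ℝ := by
      ext; simp
    rw [h1]
    congr 1
    funext i
    simp only [coe_evalRingHom, eval_add, eval_C, eval_mul, eval_X, Pi.add_apply, Pi.smul_apply,
      smul_eq_mul]
  have h0 : f ≠ 0 := by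
    intro h0
    apply h
    have := he 0
    rw [h0, eval_zero, zero_smul, add_zero] at this
    exact this.symm
  refine (f.rootSet_finite ℝ).subset fun s hs => ?_
  rw [mem_rootSet]
  exact ⟨h0, by simpa [he] using hs⟩

variable {q : ℕ}

/-- The generic `q × q` matrix. The polynomial ring has one additional variable. -/
def genericMatrix (q : ℕ) :
    Matrix (Fin q) (Fin q) (MvPolynomial (Option (Fin q × Fin q)) ℝ) :=
  Matrix.of fun i j => MvPolynomial.X (some (i, j))

/-- The values of the variables given by the entries of a matrix and a number. -/
def matrixPoint (A : Matrix (Fin q) (Fin q) ℝ) (ε : ℝ) : Option (Fin q × Fin q) → ℝ :=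
  fun o => o.elim ε fun ij => A ij.1 ij.2

theorem genericMatrix_map (A : Matrix (Fin q) (Fin q) ℝ) (ε : ℝ) :
    (genericMatrix q).map (MvPolynomial.eval (matrixPoint A ε)) = A := by
  ext i j
  simp [genericMatrix, matrixPoint]

theorem eval_reducedDisc (A : Matrix (Fin q) (Fin q) ℝ) (ε : ℝ) :
    MvPolynomial.eval (matrixPoint A ε) (reducedDisc (genericMatrix q)) = reducedDisc A := by
  rw [← reducedDisc_map, genericMatrix_map]

theorem eval_reducedRes (A : Matrix (Fin q) (Fin q) ℝ) (ε : ℝ) :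
    MvPolynomial.eval (matrixPoint A ε) (reducedRes (genericMatrix q) (MvPolynomial.X none))
      = reducedRes A ε := by
  rw [← reducedRes_map, genericMatrix_map]
  simp [matrixPoint]

theorem continuous_matrixPoint :
    Continuous fun x : Matrix (Fin q) (Fin q) ℝ × ℝ => matrixPoint x.1 x.2 := by
  refine continuous_pi fun o => ?_
  cases o with
  | none => exact continuous_snd
  | some ij =>
    exact (continuous_apply_apply ij.1 ij.2).comp continuous_fst

theorem continuous_reducedDisc : Continuous fun A : Matrix (Fin q) (Fin q) ℝ => reducedDisc A := by
  have h := ((MvPolynomial.continuous_eval (reducedDisc (genericMatrix q))).comp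
    continuous_matrixPoint).comp (Continuous.prodMk_left (0 : ℝ))
  simpa [Function.comp_def, eval_reducedDisc] using h

theorem continuous_reducedRes :
    Continuous fun x : Matrix (Fin q) (Fin q) ℝ × ℝ => reducedRes x.1 x.2 := by
  have h := (MvPolynomial.continuous_eval (reducedRes (genericMatrix q) (MvPolynomial.X none))).comp
    continuous_matrixPoint
  simpa [Function.comp_def, eval_reducedRes] using h

theorem matrixPoint_add_smul (A B : Matrix (Fin q) (Fin q) ℝ) (s ε : ℝ) :
    matrixPoint (A + s • B) ε = matrixPoint A ε + s • matrixPoint B 0 := by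
  funext o
  cases o <;> simp [matrixPoint]

theorem isCompact_resonanceScales : IsCompact resonanceScales := by
  refine Filter.Tendsto.isCompact_insert_range ?_
  refine (Filter.Tendsto.comp (Filter.tendsto_pow_atTop (α := ℝ) two_ne_zero)
    (Filter.tendsto_atTop_add_const_right _ (2 : ℝ) tendsto_natCast_atTop_atTop)).inv_tendsto_atTop

theorem countable_resonanceScales : resonanceScales.Countable :=
  (Set.countable_range _).insert 0

/-- The nonresonant skew symmetric matrices. -/
def nonResonantMatrices (q : ℕ) : Set (SO q) :=
  {A | NonResonant (q / 2) (toEuclideanLin (A : Matrix (Fin q) (Fin q) ℝ))}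

theorem SO.transpose_eq (A : SO q) :
    (A : Matrix (Fin q) (Fin q) ℝ)ᵀ = -(A : Matrix (Fin q) (Fin q) ℝ) :=
  (LieAlgebra.Orthogonal.mem_so _ _ _).1 A.2

theorem mem_nonResonantMatrices {A : SO q} : A ∈ nonResonantMatrices q ↔
    reducedDisc (A : Matrix (Fin q) (Fin q) ℝ) ≠ 0 ∧
      ∀ ε ∈ resonanceScales, reducedRes (A : Matrix (Fin q) (Fin q) ℝ) ε ≠ 0 :=
  nonResonant_iff A.transpose_eq

/-- Infinitely many conditions are imposed. Including the limit scale `0` makes the parameter set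
compact, so nonvanishing for all `ε` at `A` persists on a neighbourhood of `A`. -/
theorem isOpen_nonResonantMatrices : IsOpen (nonResonantMatrices q) := by
  have h : IsOpen {A : Matrix (Fin q) (Fin q) ℝ | reducedDisc A ≠ 0 ∧
      ∀ ε ∈ resonanceScales, reducedRes A ε ≠ 0} := by
    refine (isOpen_ne_fun continuous_reducedDisc continuous_const).inter ?_
    refine isOpen_iff_mem_nhds.2 fun A hA => ?_
    refine isCompact_resonanceScales.eventually_forall_of_forall_eventually
      (P := fun A ε => reducedRes A ε ≠ 0) fun ε hε => ?_
    exact continuous_reducedRes.continuousAt.eventually_ne (hA ε hε)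
  convert h.preimage continuous_subtype_val using 1
  ext A
  exact mem_nonResonantMatrices

/-- Each of the countably many polynomial conditions holds at `s = 0`, hence fails for only finitely
many `s`. -/
theorem countable_resonant_line {A : SO q} (hA : A ∈ nonResonantMatrices q) (B : SO q) :
    {s : ℝ | A + s • B ∉ nonResonantMatrices q}.Countable := by
  rw [mem_nonResonantMatrices] at hA
  refine Set.Countable.mono (s₂ := {s : ℝ | MvPolynomial.eval (matrixPoint A.1 0
      + s • matrixPoint B.1 0) (reducedDisc (genericMatrix q)) = 0}
      ∪ ⋃ ε ∈ resonanceScales, {s : ℝ | MvPolynomial.eval (matrixPoint A.1 ε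
      + s • matrixPoint B.1 0) (reducedRes (genericMatrix q) (MvPolynomial.X none)) = 0}) ?_ ?_
  · intro s hs
    rw [Set.mem_ofPred_eq, mem_nonResonantMatrices] at hs
    by_contra h
    apply hs
    simp only [Set.mem_union, Set.mem_iUnion, Set.mem_ofPred_eq, ← matrixPoint_add_smul,
      eval_reducedDisc, eval_reducedRes, not_or, not_exists] at h
    exact ⟨h.1, fun ε hε => h.2 ε hε⟩
  · refine (finite_zeros_mvPolynomial_line _ _ _ ?_).countable.union
      (countable_resonanceScales.biUnion fun ε hε =>
        (finite_zeros_mvPolynomial_line _ _ _ ?_).countable)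
    · rw [eval_reducedDisc]; exact hA.1
    · rw [eval_reducedRes]; exact hA.2 ε hε

end Generic

/-! ### Full measure by Fubini -/

section Null

open MeasureTheory

/-- A measurable set which meets the lines through some point in countable sets is a null set. -/
theorem measure_eq_zero_of_countable_lines {V : Type*} [NormedAddCommGroup V] [NormedSpace ℝ V]
    [FiniteDimensional ℝ V] [MeasurableSpace V] [BorelSpace V] (μ : Measure V) [μ.IsAddHaarMeasure]
    {S : Set V} (hS : MeasurableSet S) (a : V)
    (h : ∀ v : V, {s : ℝ | a + s • v ∈ S}.Countable) : μ S = 0 := by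
  set S' : Set V := (fun v => a + v) ⁻¹' S with hS'
  have hS'm : MeasurableSet S' := hS.preimage (measurable_const_add a)
  rw [← measure_preimage_add μ a S, ← hS']
  have hT : MeasurableSet {x : V × ℝ | x.2 • x.1 ∈ S'} :=
    hS'm.preimage ((continuous_snd.smul continuous_fst).measurable)
  -- For fixed `v` the slice in `s` is countable. Exchanging the factors, for almost every `s` the
  -- set of `v` with `s • v ∈ S'` is null; a single such `s ≠ 0` suffices, since scaling preserves
  -- null sets.
  have h1 : (μ.prod (volume : Measure ℝ)) {x : V × ℝ | x.2 • x.1 ∈ S'} = 0 := by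
    rw [Measure.measure_prod_null hT]
    exact Filter.Eventually.of_forall fun v => (h v).measure_zero volume
  have hT2 : MeasurableSet {x : ℝ × V | x.1 • x.2 ∈ S'} :=
    hS'm.preimage ((continuous_fst.smul continuous_snd).measurable)
  have h2 : ((volume : Measure ℝ).prod μ) {x : ℝ × V | x.1 • x.2 ∈ S'} = 0 := by
    rw [← Measure.prod_swap, Measure.map_apply measurable_swap hT2]
    exact h1
  rw [Measure.measure_prod_null hT2] at h2
  have h3 : ∀ᵐ s : ℝ, s ≠ 0 := by
    simp [ae_iff]
  obtain ⟨s, hs, hs0⟩ := (h2.and h3).exists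
  have h4 : μ ((fun v : V => s • v) ⁻¹' S') = 0 := hs
  rw [Measure.addHaar_preimage_smul μ hs0, mul_eq_zero] at h4
  refine h4.resolve_left ?_
  simp [hs0]

variable {q : ℕ} {V : Type*} [NormedAddCommGroup V] [InnerProductSpace ℝ V] [FiniteDimensional ℝ V]

/-- The inclusion of the skew symmetric matrices into all matrices. -/
def SO.val (q : ℕ) : SO q →ₗ[ℝ] Matrix (Fin q) (Fin q) ℝ where
  toFun A := A
  map_add' _ _ := rfl
  map_smul' _ _ := rfl

theorem SO.continuous_linearMap (L : V →ₗ[ℝ] SO q) : Continuous L :=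
  Continuous.subtype_mk (LinearMap.continuous_of_finiteDimensional
    (SO.val q ∘ₗ L)) _

/-- The nonresonant elements of a space of skew symmetric matrices form an open dense set of full
measure, as soon as there is one of them. -/
theorem nonResonant_preimage (L : V →ₗ[ℝ] SO q) (h : ∃ Z, L Z ∈ nonResonantMatrices q) :
    IsOpen (L ⁻¹' nonResonantMatrices q) ∧ Dense (L ⁻¹' nonResonantMatrices q) ∧
      IsLebesgueNull (L ⁻¹' nonResonantMatrices q)ᶜ := by
  let _ : MeasurableSpace V := borel V
  have _ : BorelSpace V := ⟨rfl⟩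
  obtain ⟨Z₀, hZ₀⟩ := h
  have ho : IsOpen (L ⁻¹' nonResonantMatrices q) :=
    isOpen_nonResonantMatrices.preimage (SO.continuous_linearMap L)
  have hn : volume (L ⁻¹' nonResonantMatrices q)ᶜ = 0 := by
    refine measure_eq_zero_of_countable_lines volume ho.isClosed_compl.measurableSet Z₀ fun v => ?_
    simpa using countable_resonant_line hZ₀ (L v)
  refine ⟨ho, ?_, hn⟩
  exact Measure.dense_of_ae (μ := volume) (p := fun Z => L Z ∈ nonResonantMatrices q) hn

end Null

/-! ### A nonresonant skew matrix -/

section Existence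

open Matrix

/-- The frequencies of the model matrix. -/
def modelFrequency (q k : ℕ) : ℝ := 1 + k / q

/-- A block diagonal skew symmetric matrix with frequencies in `[1, 2)`. -/
def modelMatrix (q : ℕ) : Matrix (Fin q) (Fin q) ℝ := Matrix.of fun i j =>
  if (i : ℕ) % 2 = 0 ∧ (j : ℕ) = i + 1 then modelFrequency q (i / 2)
  else if (j : ℕ) % 2 = 0 ∧ (i : ℕ) = j + 1 then - modelFrequency q (j / 2) else 0

theorem modelMatrix_transpose (q : ℕ) : (modelMatrix q)ᵀ = - modelMatrix q := by
  ext i j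
  simp only [modelMatrix, transpose_apply, of_apply, Matrix.neg_apply]
  split_ifs <;> first | omega | simp

theorem modelMatrix_single {q k : ℕ} (h : 2 * k + 1 < q) :
    toEuclideanLin (modelMatrix q) (EuclideanSpace.single ⟨2 * k, by omega⟩ 1)
      = - modelFrequency q k • EuclideanSpace.single ⟨2 * k + 1, h⟩ 1 := by
  ext i
  simp only [toLpLin_apply, PiLp.ofLp_single, mulVec_single_one, col_apply, modelMatrix,
    of_apply, PiLp.smul_apply, PiLp.single_apply, Fin.ext_iff, smul_eq_mul]
  by_cases hi : (i : ℕ) = 2 * k + 1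
  · rw [if_neg (by omega), if_pos (by omega), if_pos hi, mul_one]
    congr 2; omega
  · rw [if_neg (by omega), if_neg (by omega), if_neg hi, mul_zero]

theorem modelMatrix_single_succ {q k : ℕ} (h : 2 * k + 1 < q) :
    toEuclideanLin (modelMatrix q) (EuclideanSpace.single ⟨2 * k + 1, h⟩ 1)
      = modelFrequency q k • EuclideanSpace.single ⟨2 * k, by omega⟩ 1 := by
  ext i
  simp only [toLpLin_apply, PiLp.ofLp_single, mulVec_single_one, col_apply, modelMatrix,
    of_apply, PiLp.smul_apply, PiLp.single_apply, Fin.ext_iff, smul_eq_mul]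
  by_cases hi : (i : ℕ) = 2 * k
  · rw [if_pos (by omega), if_pos hi, mul_one]
    congr 1; omega
  · rw [if_neg (by omega), if_neg (by omega), if_neg hi, mul_zero]

/-- The blocks supply `q / 2` distinct frequencies, the largest number possible, so there are no
others. All lie in `[1, 2)`, where no element is at least twice another. -/
theorem modelMatrix_nonResonant (q : ℕ) :
    NonResonant (q / 2) (toEuclideanLin (modelMatrix q)) := by
  have hinj : Set.InjOn (modelFrequency q) (Finset.range (q / 2) : Set ℕ) := by
    intro a ha b hb h
    have hq : 0 < q := by
      have := Finset.mem_range.1 (Finset.mem_coe.1 ha); omega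
    have hq' : (0 : ℝ) < q := by exact_mod_cast hq
    simp only [modelFrequency] at h
    field_simp at h
    exact_mod_cast add_left_cancel h
  have hpos (k : ℕ) : 1 ≤ modelFrequency q k := by
    unfold modelFrequency
    have : (0 : ℝ) ≤ k / q := by positivity
    linarith
  have hlt {k : ℕ} (hk : k ∈ Finset.range (q / 2)) : modelFrequency q k < 2 := by
    have hk' := Finset.mem_range.1 hk
    unfold modelFrequency
    have hq : (0 : ℝ) < q := by
      have : 0 < q := by omega
      exact_mod_cast this
    have h2 : (k : ℝ) / q < 1 := by
      rw [div_lt_one hq]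
      have : k < q := by omega
      exact_mod_cast this
    linarith
  have hsub : modelFrequency q '' (Finset.range (q / 2) : Set ℕ)
      ⊆ frequencies (toEuclideanLin (modelMatrix q)) := by
    rintro _ ⟨k, hk, rfl⟩
    have hk' := Finset.mem_range.1 (Finset.mem_coe.1 hk)
    have h : 2 * k + 1 < q := by omega
    refine ⟨by linarith [hpos k], EuclideanSpace.single ⟨2 * k, by omega⟩ 1, by simp, ?_⟩
    rw [modelMatrix_single h, map_smul, modelMatrix_single_succ h, smul_smul]
    congr 1
    ring
  have hcard : (modelFrequency q '' (Finset.range (q / 2) : Set ℕ)).encard = (q / 2 : ℕ) := by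
    rw [hinj.encard_image, Set.encard_coe_eq_coe_finsetCard, Finset.card_range]
  have heq := ((Finset.range (q / 2)).finite_toSet.image (modelFrequency q)).eq_of_subset_of_encard_le
    hsub (by rw [hcard]; exact encard_frequencies_le (modelMatrix_transpose q))
  rw [NonResonant, ← heq]
  refine ⟨hcard, ?_⟩
  rintro _ ⟨k, -, rfl⟩ _ ⟨l, hl, rfl⟩ m hm h
  have h1 := hlt hl
  have h2 : (2 : ℝ) ≤ m := by exact_mod_cast hm
  nlinarith [hpos k]

theorem nonResonantMatrices_nonempty (q : ℕ) : (nonResonantMatrices q).Nonempty :=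
  ⟨⟨modelMatrix q, (LieAlgebra.Orthogonal.mem_so _ _ _).2 (modelMatrix_transpose q)⟩,
    modelMatrix_nonResonant q⟩

end Existence

/-! ### Open dense set of nonresonant frames -/

section Frames

variable {p q : ℕ}

theorem frameMap_apply (C : Frames p q) (z : EuclideanSpace ℝ (Fin p)) :
    frameMap C z = ∑ k, z k • C.1 k := rfl

/-- The entries of a skew symmetric matrix. -/
def SO.entries (q : ℕ) : SO q →ₗ[ℝ] (Fin q → Fin q → ℝ) where
  toFun A := A.1
  map_add' _ _ := rfl
  map_smul' _ _ := rfl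

theorem SO.entries_injective (q : ℕ) : Function.Injective (SO.entries q) :=
  fun _ _ h => Subtype.ext h

theorem SO.isInducing_entries (q : ℕ) : Topology.IsInducing (SO.entries q) := ⟨rfl⟩

theorem isOpen_linearIndependent : IsOpen {C : Fin p → SO q | LinearIndependent ℝ C} := by
  have h : IsOpen {C : Fin p → Fin q → Fin q → ℝ | LinearIndependent ℝ C} :=
    isOpen_setOfPred_linearIndependent
  have hc : Continuous fun C : Fin p → SO q => fun k => SO.entries q (C k) :=
    continuous_pi fun k => (SO.isInducing_entries q).continuous.comp (continuous_apply k)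
  convert h.preimage hc using 1
  ext C
  exact (LinearMap.linearIndependent_iff_of_injOn (v := C) (SO.entries q)
    (SO.entries_injective q).injOn).symm

/-- The frames whose span contains a nonresonant matrix. -/
def nonResonantFrames (p q : ℕ) : Set (Frames p q) :=
  {C | ∃ z, frameMap C z ∈ nonResonantMatrices q}

theorem isOpen_nonResonantFrames : IsOpen (nonResonantFrames p q) := by
  have h : nonResonantFrames p q = ⋃ z, (fun C => frameMap C z) ⁻¹' nonResonantMatrices q := by
    ext C; simp [nonResonantFrames]
  rw [h]
  refine isOpen_iUnion fun z => isOpen_nonResonantMatrices.preimage ?_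
  rw [(SO.isInducing_entries q).continuous_iff]
  have : (SO.entries q ∘ fun C : Frames p q => frameMap C z)
      = fun C => ∑ k, z k • SO.entries q (C.1 k) := by
    funext C
    simp [frameMap_apply, map_sum]
  rw [this]
  have hk (k : Fin p) : Continuous fun C : Frames p q => SO.entries q (C.1 k) :=
    (SO.isInducing_entries q).continuous.comp ((continuous_apply k).comp continuous_subtype_val)
  exact continuous_finsetSum _ fun k _ => (hk k).const_smul (z k)

/-- It suffices to move one vector of the frame along the line joining it to a nonresonant `A`. Only
countably many parameters are resonant, and linear independence is an open condition. -/
theorem dense_nonResonantFrames (hp : 0 < p) : Dense (nonResonantFrames p q) := by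
  obtain ⟨A, hA⟩ := nonResonantMatrices_nonempty q
  rw [dense_iff_inter_open]
  rintro U hU ⟨C, hC⟩
  obtain ⟨U', hU', rfl⟩ := isOpen_induced_iff.1 hU
  let k₀ : Fin p := ⟨0, hp⟩
  let c : ℝ → Fin p → SO q := fun r => Function.update C.1 k₀ (A + r • (C.1 k₀ - A))
  have hcont : Continuous c := by
    refine continuous_const.update _ ?_
    rw [(SO.isInducing_entries q).continuous_iff]
    have : (SO.entries q ∘ fun r : ℝ => A + r • (C.1 k₀ - A))
        = fun r => SO.entries q A + r • SO.entries q (C.1 k₀ - A) := by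
      funext r
      simp
    rw [this]
    fun_prop
  -- Parameter `1` is the given frame, so parameters near `1` stay in `U'` and remain independent.
  have hc1 : c 1 = C.1 := by simp [c]
  have ho : IsOpen (c ⁻¹' (U' ∩ {C : Fin p → SO q | LinearIndependent ℝ C})) :=
    (hU'.inter isOpen_linearIndependent).preimage hcont
  have hd : Dense {s : ℝ | A + s • (C.1 k₀ - A) ∉ nonResonantMatrices q}ᶜ :=
    (countable_resonant_line hA _).dense_compl ℝ
  obtain ⟨r, hr, hr'⟩ := hd.inter_open_nonempty _ ho ⟨1, by
    rw [Set.mem_preimage, hc1]; exact ⟨hC, C.2⟩⟩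
  refine ⟨⟨c r, hr.2⟩, hr.1, EuclideanSpace.single k₀ 1, ?_⟩
  have : frameMap ⟨c r, hr.2⟩ (EuclideanSpace.single k₀ 1) = A + r • (C.1 k₀ - A) := by
    rw [frameMap_apply, Finset.sum_eq_single k₀]
    · simp [c]
    · intro k _ hk
      simp [hk]
    · simp
  rw [this]
  simpa using hr'

theorem range_frameMap (C : Frames p q) :
    LinearMap.range (frameMap C) = Submodule.span ℝ (Set.range C.1) := by
  rw [frameMap, LinearMap.range_comp_of_range_eq_top _ (LinearEquiv.range _),
    Fintype.range_linearCombination]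

theorem frameSpan_surjective : Function.Surjective (frameSpan (p := p) (q := q)) := by
  rintro ⟨W, hW⟩
  have _ : FiniteDimensional ℝ W := inferInstanceAs (FiniteDimensional ℝ (TraceSpace W))
  let b := Module.finBasisOfFinrankEq ℝ W hW
  refine ⟨⟨fun k => b k, b.linearIndependent.map' W.subtype W.ker_subtype⟩, Subtype.ext ?_⟩
  change Submodule.span ℝ (Set.range (W.subtype ∘ b)) = W
  rw [Set.range_comp, ← Submodule.map_span, b.span_eq, Submodule.map_top, Submodule.range_subtype]

end Frames

/-! ### Frequencies of the algebra `ℝ^q ⊕ W` -/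

section Model

variable {p q : ℕ} {W : Type} [NormedAddCommGroup W] [InnerProductSpace ℝ W]
  [FiniteDimensional ℝ W] {j : W →ₗ[ℝ] SO q} (hj : Function.Injective j)
  (hp : Module.finrank ℝ W = p)

/-- Brackets lie in the summand `W`, and equality of the spans follows by comparing dimensions. -/
theorem mem_derived_metricLieOfJ_iff (hj : Function.Injective j) (x : WithLp 2 (EuclideanSpace ℝ (Fin q) × W)) :
    x ∈ derivedSpan (jLie j) ↔ x.fst = 0 := by
  let ι : W →ₗ[ℝ] WithLp 2 (EuclideanSpace ℝ (Fin q) × W) :=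
    (WithLp.linearEquiv 2 ℝ (EuclideanSpace ℝ (Fin q) × W)).symm.toLinearMap ∘ₗ
      LinearMap.inr ℝ _ _
  have hι : Function.Injective ι :=
    (WithLp.linearEquiv 2 ℝ (EuclideanSpace ℝ (Fin q) × W)).symm.injective.comp
      LinearMap.inr_injective
  have hle : derivedSpan (jLie j) ≤ LinearMap.range ι := by
    refine Submodule.span_le.2 ?_
    rintro _ ⟨x, y, rfl⟩
    exact ⟨jBracket j x.fst y.fst, rfl⟩
  have heq : derivedSpan (jLie j) = LinearMap.range ι :=
    Submodule.eq_of_le_of_finrank_eq hle (by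
      rw [finrank_derivedSpan_jLie j hj, LinearMap.finrank_range_of_inj hι])
  rw [heq]
  constructor
  · rintro ⟨Z, rfl⟩
    rfl
  · intro h
    refine ⟨x.snd, ?_⟩
    change WithLp.toLp 2 (0, x.snd) = x
    rw [← h]
    rfl

theorem jMap_metricLieOfJ (Z : W) (x : WithLp 2 (EuclideanSpace ℝ (Fin q) × W)) :
    (metricLieOfJ j hj hp).jMap (WithLp.toLp 2 (0, Z)) x
      = WithLp.toLp 2 (Matrix.toEuclideanLin (j Z : Matrix (Fin q) (Fin q) ℝ) x.fst, 0) := by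
  have h (y : WithLp 2 (EuclideanSpace ℝ (Fin q) × W)) :
      inner ℝ (WithLp.toLp 2 ((0 : EuclideanSpace ℝ (Fin q)), Z)) (jLie j x y)
        = inner ℝ (WithLp.toLp 2
          (Matrix.toEuclideanLin (j Z : Matrix (Fin q) (Fin q) ℝ) x.fst, (0 : W))) y := by
    rw [WithLp.prod_inner_apply, WithLp.prod_inner_apply]
    change inner ℝ 0 (0 : EuclideanSpace ℝ (Fin q)) + inner ℝ Z (jBracket j x.fst y.fst)
      = inner ℝ (Matrix.toEuclideanLin (j Z : Matrix (Fin q) (Fin q) ℝ) x.fst) y.fst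
        + inner ℝ 0 y.snd
    rw [inner_zero_left, inner_zero_left, zero_add, add_zero, real_inner_comm, inner_jBracket]
  exact ext_inner_right ℝ fun y => ((metricLieOfJ j hj hp).inner_jMap _ _ _).trans (h y)

/-- The operator is `j Z` on `ℝ^q` extended by zero on `W`; the zero block contributes no positive
frequency. -/
theorem frequencies_metricLieOfJ (Z : W) :
    frequencies ((metricLieOfJ j hj hp).jMap (WithLp.toLp 2 (0, Z)))
      = frequencies (Matrix.toEuclideanLin (j Z : Matrix (Fin q) (Fin q) ℝ)) := by
  ext θ
  refine and_congr_right fun hθ => ?_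
  constructor
  · rintro ⟨(w : WithLp 2 (EuclideanSpace ℝ (Fin q) × W)), hw, h⟩
    rw [jMap_metricLieOfJ, jMap_metricLieOfJ] at h
    have h1 : Matrix.toEuclideanLin (j Z : Matrix (Fin q) (Fin q) ℝ)
        (Matrix.toEuclideanLin (j Z : Matrix (Fin q) (Fin q) ℝ) w.fst) = -(θ ^ 2) • w.fst :=
      congrArg WithLp.fst h
    have h2 : (0 : W) = -(θ ^ 2) • w.snd := congrArg WithLp.snd h
    refine ⟨w.fst, fun h0 => hw ?_, h1⟩
    have h3 : w.snd = 0 := by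
      rcases smul_eq_zero.1 h2.symm with h4 | h4
      · nlinarith [sq_pos_of_pos hθ]
      · exact h4
    change w = WithLp.toLp 2 (0, 0)
    rw [← h0, ← h3]
    rfl
  · rintro ⟨v, hv, h⟩
    refine ⟨WithLp.toLp 2 (v, 0), fun h0 => hv (congrArg WithLp.fst h0), ?_⟩
    rw [jMap_metricLieOfJ, jMap_metricLieOfJ]
    change WithLp.toLp 2 (Matrix.toEuclideanLin (j Z : Matrix (Fin q) (Fin q) ℝ)
        (Matrix.toEuclideanLin (j Z : Matrix (Fin q) (Fin q) ℝ) v), 0)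
        = -(θ ^ 2) • WithLp.toLp 2 (v, (0 : W))
    rw [h, ← WithLp.toLp_smul 2 (-(θ ^ 2)) (v, (0 : W)), Prod.smul_mk, smul_zero]

end Model

/-! ### Genericity and its invariance under isometry -/

namespace MetricLieAlgebra

variable {p q : ℕ}

/-- Some element of the commutator ideal is nonresonant. -/
def IsGeneric (N : MetricLieAlgebra p q) : Prop :=
  ∃ Z ∈ N.derived, NonResonant (q / 2) (N.jMap Z)

theorem isGeneric_metricLieOfJ_iff {W : Type} [NormedAddCommGroup W] [InnerProductSpace ℝ W]
    [FiniteDimensional ℝ W] {j : W →ₗ[ℝ] SO q} (hj : Function.Injective j)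
    (hp : Module.finrank ℝ W = p) :
    (metricLieOfJ j hj hp).IsGeneric ↔ ∃ Z, j Z ∈ nonResonantMatrices q := by
  constructor
  · rintro ⟨(x : WithLp 2 (EuclideanSpace ℝ (Fin q) × W)), hx, h⟩
    have hx0 : x.fst = 0 := (mem_derived_metricLieOfJ_iff hj x).1 hx
    have hx1 : x = WithLp.toLp 2 (0, x.snd) := by rw [← hx0]; rfl
    refine ⟨x.snd, ?_⟩
    rw [hx1, NonResonant, frequencies_metricLieOfJ] at h
    exact h
  · rintro ⟨Z, hZ⟩
    refine ⟨WithLp.toLp 2 (0, Z), (mem_derived_metricLieOfJ_iff hj _).2 rfl, ?_⟩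
    rw [NonResonant, frequencies_metricLieOfJ]
    exact hZ

section Isometry

variable {N M : MetricLieAlgebra p q} (φ : N.carrier ≃ₗᵢ[ℝ] M.carrier)
  (hφ : ∀ x y, φ (N.bracket x y) = M.bracket (φ x) (φ y))

include hφ

theorem map_mem_derived {Z : N.carrier} (hZ : Z ∈ N.derived) : φ Z ∈ M.derived := by
  have h : N.derived ≤ M.derived.comap φ.toLinearEquiv.toLinearMap := by
    refine Submodule.span_le.2 ?_
    rintro _ ⟨x, y, rfl⟩
    change φ _ ∈ M.derived
    rw [hφ]
    exact M.bracket_mem_derived _ _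
  exact h hZ

theorem map_jMap (Z x : N.carrier) : φ (N.jMap Z x) = M.jMap (φ Z) (φ x) := by
  refine ext_inner_right ℝ fun y => ?_
  obtain ⟨y, rfl⟩ := φ.surjective y
  rw [φ.inner_map_map, inner_jMap, inner_jMap, ← hφ, φ.inner_map_map]

theorem frequencies_map (Z : N.carrier) :
    frequencies (M.jMap (φ Z)) = frequencies (N.jMap Z) := by
  ext θ
  refine and_congr_right fun _ => ?_
  constructor
  · rintro ⟨w, hw, h⟩
    obtain ⟨w, rfl⟩ := φ.surjective w
    refine ⟨w, by simpa using hw, φ.injective ?_⟩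
    rw [map_jMap φ hφ, map_jMap φ hφ, h, map_smul]
  · rintro ⟨w, hw, h⟩
    refine ⟨φ w, by simpa using hw, ?_⟩
    rw [← map_jMap φ hφ, ← map_jMap φ hφ, h, map_smul]

end Isometry

theorem Isometric.isGeneric {N M : MetricLieAlgebra p q} (h : Isometric N M) (hN : N.IsGeneric) :
    M.IsGeneric := by
  obtain ⟨φ, hφ⟩ := h
  obtain ⟨Z, hZ, h⟩ := hN
  refine ⟨φ Z, map_mem_derived φ hφ hZ, ?_⟩
  rwa [NonResonant, frequencies_map φ hφ]

/-! ### Every class contains the algebra of a frame -/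

section Frame

variable (N : MetricLieAlgebra p q)

theorem finrank_derived_orthogonal : Module.finrank ℝ N.derivedᗮ = q := by
  have h := N.derived.finrank_add_finrank_orthogonal
  rw [N.finrank_carrier, N.finrank_derived] at h
  omega

/-- An orthonormal basis of the commutator ideal. -/
def derivedBasis : OrthonormalBasis (Fin p) ℝ N.derived :=
  (stdOrthonormalBasis ℝ N.derived).reindex (finCongr N.finrank_derived)

/-- An orthonormal basis of the orthogonal complement of the commutator ideal. -/
def complBasis : OrthonormalBasis (Fin q) ℝ N.derivedᗮ :=
  (stdOrthonormalBasis ℝ N.derivedᗮ).reindex (finCongr N.finrank_derived_orthogonal)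

/-- The structure matrices of a metric Lie algebra in the chosen orthonormal bases. -/
def structureMatrix (k : Fin p) : SO q :=
  ⟨Matrix.of fun i l => inner ℝ (N.bracket (N.complBasis l) (N.complBasis i))
      (N.derivedBasis k : N.carrier), by
    rw [LieAlgebra.Orthogonal.mem_so]
    ext i l
    simp only [Matrix.transpose_apply, Matrix.of_apply, Matrix.neg_apply]
    rw [N.bracket_skew, inner_neg_left]⟩

theorem inner_sum_structureMatrix (z : EuclideanSpace ℝ (Fin p)) (v w : EuclideanSpace ℝ (Fin q)) :
    inner ℝ (Matrix.toEuclideanLin ((∑ k, z k • N.structureMatrix k : SO q) :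
      Matrix (Fin q) (Fin q) ℝ) v) w
      = inner ℝ (N.bracket (N.complBasis.repr.symm v) (N.complBasis.repr.symm w))
        (N.derivedBasis.repr.symm z : N.carrier) := by
  have hm : ((∑ k, z k • N.structureMatrix k : SO q) : Matrix (Fin q) (Fin q) ℝ)
      = ∑ k, z k • (N.structureMatrix k : Matrix (Fin q) (Fin q) ℝ) := by
    change SO.val q _ = _
    rw [map_sum]
    rfl
  rw [hm, ← N.complBasis.sum_repr_symm v, ← N.complBasis.sum_repr_symm w,
    ← N.derivedBasis.sum_repr_symm z]
  simp only [Submodule.coe_sum, Submodule.coe_smul, map_sum, map_smul, LinearMap.sum_apply,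
    LinearMap.smul_apply, sum_inner, inner_sum, inner_smul_left, inner_smul_right, conj_trivial]
  simp only [structureMatrix, Matrix.toLpLin_apply, PiLp.inner_apply, Matrix.mulVec, dotProduct,
    Matrix.of_apply, RCLike.inner_apply, conj_trivial, Finset.mul_sum]
  refine Finset.sum_congr rfl fun k _ => ?_
  refine Finset.sum_congr rfl fun i _ => Finset.sum_congr rfl fun l _ => ?_
  ring

/-- A linear relation with coefficients `g` gives the element of the commutator ideal with
coordinates `g`. It is orthogonal to every bracket, hence to the whole ideal and to itself. -/
theorem linearIndependent_structureMatrix : LinearIndependent ℝ N.structureMatrix := by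
  rw [Fintype.linearIndependent_iff]
  intro g hg k
  have h0 : N.derivedBasis.repr.symm (WithLp.toLp 2 g) = 0 := by
    have key (x y : N.carrier) : inner ℝ (N.bracket x y)
        (N.derivedBasis.repr.symm (WithLp.toLp 2 g) : N.carrier) = 0 := by
      -- Components in the commutator ideal are central, so brackets only see the orthogonal
      -- complement, where the structure matrices compute them.
      have hd (x : N.carrier) : ∃ v, ∃ d ∈ N.derived, x = d + N.complBasis.repr.symm v := by
        obtain ⟨d, hd, e, he, rfl⟩ := N.derived.exists_add_mem_mem_orthogonal x
        exact ⟨N.complBasis.repr ⟨e, he⟩, d, hd, by simp⟩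
      obtain ⟨v, d, hd1, rfl⟩ := hd x
      obtain ⟨w, e, he1, rfl⟩ := hd y
      rw [map_add, map_add, LinearMap.add_apply, N.bracket_derived hd1,
        N.bracket_derived_right he1, zero_add, zero_add, LinearMap.add_apply,
        N.bracket_derived hd1, zero_add, ← N.inner_sum_structureMatrix]
      change inner ℝ (Matrix.toEuclideanLin ((∑ k, g k • N.structureMatrix k : SO q) :
        Matrix (Fin q) (Fin q) ℝ) v) w = 0
      rw [hg]
      simp
    have hmem : (N.derivedBasis.repr.symm (WithLp.toLp 2 g) : N.carrier) ∈ N.derivedᗮ := by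
      have hle : N.derived ≤ (ℝ ∙ (N.derivedBasis.repr.symm (WithLp.toLp 2 g) : N.carrier))ᗮ := by
        refine Submodule.span_le.2 ?_
        rintro _ ⟨x, y, rfl⟩
        exact Submodule.mem_orthogonal_singleton_iff_inner_left.2 (key x y)
      rw [Submodule.mem_orthogonal]
      intro u hu
      exact Submodule.mem_orthogonal_singleton_iff_inner_left.1 (hle hu)
    apply Subtype.ext
    rw [ZeroMemClass.coe_zero, ← inner_self_eq_zero (𝕜 := ℝ)]
    exact (Submodule.mem_orthogonal _ _).1 hmem _ (Subtype.coe_prop _)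
  have h1 : WithLp.toLp 2 g = 0 := N.derivedBasis.repr.symm.injective (by rw [h0, map_zero])
  exact congrFun (congrArg WithLp.ofLp h1) k

/-- The frame of structure matrices. -/
def structureFrame : Frames p q := ⟨N.structureMatrix, N.linearIndependent_structureMatrix⟩

/-- The isometry of `ℝ^q ⊕ ℝ^p` onto `𝔑` given by the orthonormal bases. -/
def frameIsometry :
    WithLp 2 (EuclideanSpace ℝ (Fin q) × EuclideanSpace ℝ (Fin p)) ≃ₗᵢ[ℝ] N.carrier :=
  LinearIsometry.toLinearIsometryEquiv
    { toFun := fun x => (N.complBasis.repr.symm x.fst : N.carrier)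
        + (N.derivedBasis.repr.symm x.snd : N.carrier)
      map_add' := fun x y => by
        simp only [WithLp.add_fst, WithLp.add_snd, map_add, Submodule.coe_add]
        abel
      map_smul' := fun c x => by
        simp only [WithLp.smul_fst, WithLp.smul_snd, map_smul, Submodule.coe_smul, smul_add,
          RingHom.id_apply]
      norm_map' := fun x => by
        change ‖(N.complBasis.repr.symm x.fst : N.carrier)
          + (N.derivedBasis.repr.symm x.snd : N.carrier)‖ = ‖x‖
        rw [← sq_eq_sq₀ (norm_nonneg _) (norm_nonneg _), WithLp.prod_norm_sq_eq_of_L2, sq,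
          norm_add_sq_eq_norm_sq_add_norm_sq_real, ← sq, ← sq, ← Submodule.coe_norm,
          ← Submodule.coe_norm, LinearIsometryEquiv.norm_map, LinearIsometryEquiv.norm_map]
        exact Submodule.inner_left_of_mem_orthogonal (Subtype.coe_prop _) (Subtype.coe_prop _) }
    (by
      rw [LinearEquiv.finrank_eq (WithLp.linearEquiv 2 ℝ _), Module.finrank_prod,
        finrank_euclideanSpace_fin, finrank_euclideanSpace_fin, N.finrank_carrier, add_comm])

theorem frameIsometry_apply
    (x : WithLp 2 (EuclideanSpace ℝ (Fin q) × EuclideanSpace ℝ (Fin p))) :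
    N.frameIsometry x = (N.complBasis.repr.symm x.fst : N.carrier)
        + (N.derivedBasis.repr.symm x.snd : N.carrier) := rfl

theorem frameIsometry_bracket
    (x y : WithLp 2 (EuclideanSpace ℝ (Fin q) × EuclideanSpace ℝ (Fin p))) :
    N.frameIsometry (jLie (frameMap N.structureFrame) x y)
      = N.bracket (N.frameIsometry x) (N.frameIsometry y) := by
  rw [jLie_apply, frameIsometry_apply, frameIsometry_apply, frameIsometry_apply, map_add,
    N.bracket_derived_right (Subtype.coe_prop (N.derivedBasis.repr.symm y.snd)), add_zero, map_add,
    LinearMap.add_apply, N.bracket_derived (Subtype.coe_prop (N.derivedBasis.repr.symm x.snd)),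
    add_zero]
  have hmem := N.bracket_mem_derived (N.complBasis.repr.symm x.fst) (N.complBasis.repr.symm y.fst)
  change ((N.complBasis.repr.symm 0 : N.derivedᗮ) : N.carrier)
    + ((N.derivedBasis.repr.symm (jBracket (frameMap N.structureFrame) x.fst y.fst) : N.derived)
      : N.carrier) = ((⟨_, hmem⟩ : N.derived) : N.carrier)
  rw [map_zero, ZeroMemClass.coe_zero, zero_add]
  congr 1
  rw [LinearIsometryEquiv.symm_apply_eq]
  refine ext_inner_right ℝ fun z => ?_
  rw [inner_jBracket, frameMap_apply]
  refine (N.inner_sum_structureMatrix z x.fst y.fst).trans ?_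
  obtain ⟨Z, rfl⟩ := N.derivedBasis.repr.surjective z
  rw [LinearIsometryEquiv.symm_apply_apply, LinearIsometryEquiv.inner_map_map]
  rfl

theorem isometric_frame : Isometric (metricLieOfFrame N.structureFrame) N :=
  ⟨N.frameIsometry, N.frameIsometry_bracket⟩

end Frame

/-- The commutator ideal is represented by skew symmetric matrices with the same frequencies. -/
theorem exists_linearMap_frequencies (N : MetricLieAlgebra p q) :
    ∃ L : N.derived →ₗ[ℝ] SO q, ∀ Z : N.derived, frequencies (N.jMap Z)
      = frequencies (Matrix.toEuclideanLin (L Z : Matrix (Fin q) (Fin q) ℝ)) := by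
  refine ⟨frameMap N.structureFrame ∘ₗ N.derivedBasis.repr.toLinearEquiv.toLinearMap, fun Z => ?_⟩
  have h := frequencies_metricLieOfJ (frameMap_injective N.structureFrame)
    finrank_euclideanSpace_fin (N.derivedBasis.repr Z)
  refine Eq.trans ?_ h
  refine Eq.trans ?_ (frequencies_map (N := metricLieOfFrame N.structureFrame) (M := N)
    N.frameIsometry N.frameIsometry_bracket _)
  congr 2
  refine Eq.trans ?_ (N.frameIsometry_apply _).symm
  simp

end MetricLieAlgebra

/-! ### The generic set in `I(p, q)` and in the Grassmannian -/

section Moduli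

open MetricLieAlgebra

variable {p q : ℕ}

/-- The classes of the generic metric Lie algebras. -/
def genericClasses (p q : ℕ) : Set (IsometryClasses p q) :=
  {c | ∃ N : MetricLieAlgebra p q, isometryClass N = c ∧ N.IsGeneric}

theorem isometryClass_mem_genericClasses (N : MetricLieAlgebra p q) :
    isometryClass N ∈ genericClasses p q ↔ N.IsGeneric := by
  constructor
  · rintro ⟨M, hM, h⟩
    have hMN : Isometric M N := Quotient.exact hM
    exact hMN.isGeneric h
  · exact fun h => ⟨N, rfl, h⟩

theorem preimage_genericClasses :
    (fun C : Frames p q => isometryClass (metricLieOfFrame C)) ⁻¹' genericClasses p q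
      = nonResonantFrames p q := by
  ext C
  exact (isometryClass_mem_genericClasses _).trans
    (isGeneric_metricLieOfJ_iff (frameMap_injective C) finrank_euclideanSpace_fin)

/-- Whether some `j(Z)` is nonresonant depends only on the image of `j`, not on the inner product of
its source. The inclusion of the span and `frameMap C` have the same image. -/
theorem preimage_genericClasses_frameSpan :
    frameSpan ⁻¹' {W : Grass p q | isometryClass (standardForm W) ∈ genericClasses p q}
      = nonResonantFrames p q := by
  ext C
  refine (isometryClass_mem_genericClasses _).trans
    ((isGeneric_metricLieOfJ_iff (traceIncl_injective _) (frameSpan C).2).trans ?_)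
  have hr := range_frameMap C
  constructor
  · rintro ⟨Z, hZ⟩
    have hmem : traceIncl (frameSpan C).1 Z ∈ LinearMap.range (frameMap C) := by
      rw [hr]; exact Z.2
    obtain ⟨z, hz⟩ := hmem
    exact ⟨z, by rwa [hz]⟩
  · rintro ⟨z, hz⟩
    have hmem : frameMap C z ∈ (frameSpan C).1 := by
      have := LinearMap.mem_range_self (frameMap C) z
      rwa [hr] at this
    exact ⟨(⟨frameMap C z, hmem⟩ : (frameSpan C).1), hz⟩

theorem isometryClass_frame_surjective :
    Function.Surjective fun C : Frames p q => isometryClass (metricLieOfFrame C) := by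
  intro c
  induction c using Quotient.inductionOn with
  | h N => exact ⟨N.structureFrame, Quotient.sound N.isometric_frame⟩

theorem isOpen_genericClasses : IsOpen (genericClasses p q) := by
  rw [isOpen_coinduced, preimage_genericClasses]
  exact isOpen_nonResonantFrames

/-- A continuous surjection maps dense sets to dense sets. -/
theorem dense_genericClasses (hp : 0 < p) : Dense (genericClasses p q) := by
  have hc : Continuous fun C : Frames p q => isometryClass (metricLieOfFrame C) :=
    continuous_coinduced_rng
  refine (isometryClass_frame_surjective.denseRange.dense_image hc
    (dense_nonResonantFrames hp)).mono ?_
  rw [← preimage_genericClasses]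
  exact Set.image_preimage_subset _ _

end Moduli

theorem corollary8p3 (p q : ℕ) (hp : 0 < p) (hq : 2 ≤ q) (hpq : p ≤ q * (q - 1) / 2) :
    ∃ U' : Set (IsometryClasses p q),
      IsOpen U' ∧ Dense U' ∧
      IsOpen {W : Grass p q | isometryClass (standardForm W) ∈ U'} ∧
      Dense {W : Grass p q | isometryClass (standardForm W) ∈ U'} ∧
      ∀ N : MetricLieAlgebra p q, isometryClass N ∈ U' →
        ∃ O : Set N.derived, IsOpen O ∧ Dense O ∧ IsLebesgueNull Oᶜ ∧
          ∀ Z ∈ O, Z ≠ 0 →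
            {t : ℝ | N.IsPrimitiveConjugateValue (Z : N.carrier) t}.encard = (q / 2 : ℕ) := by
  refine ⟨genericClasses p q, isOpen_genericClasses, dense_genericClasses hp, ?_, ?_, ?_⟩
  · rw [isOpen_coinduced, preimage_genericClasses_frameSpan]
    exact isOpen_nonResonantFrames
  · have hc : Continuous (frameSpan (p := p) (q := q)) := continuous_coinduced_rng
    refine (frameSpan_surjective.denseRange.dense_image hc (dense_nonResonantFrames hp)).mono ?_
    rw [← preimage_genericClasses_frameSpan]
    exact Set.image_preimage_subset _ _
  · intro N hN
    obtain ⟨Z₀, hZ₀, h₀⟩ := (isometryClass_mem_genericClasses N).1 hN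
    obtain ⟨L, hL⟩ := N.exists_linearMap_frequencies
    have hmem (Z : N.derived) : L Z ∈ nonResonantMatrices q ↔ NonResonant (q / 2) (N.jMap Z) := by
      rw [NonResonant, hL]
      rfl
    -- Genericity supplies one nonresonant element; the line argument then makes the nonresonant
    -- elements of the commutator ideal open, dense and of full measure.
    obtain ⟨ho, hd, hn⟩ := nonResonant_preimage L ⟨⟨Z₀, hZ₀⟩, (hmem _).2 h₀⟩
    exact ⟨_, ho, hd, hn, fun Z hZ _ => N.encard_primitive_of_nonResonant Z.2 ((hmem Z).1 hZ)⟩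

end
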